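/- Let $k$ be a field of characteristic $0$ with pairwise commuting derivations $\Delta=\{\delta_1,\dots,\delta_m\}$, let $\Theta$ be the monoid of derivative operators $\delta_1^{e_1}\cdots\delta_m^{e_m}$, let $Y=\{y_1,\dots,y_n\}$ be differential indeterminates, and let $k\{Y\}=k[\Theta Y]$ be the ring of differential polynomials. Fix a ranking on $\Theta Y$, i.e. a total order with $\theta u\ge u$ and $u\ge v\Rightarrow\theta u\ge\theta v$. For a non-constant $f$, the leader $\mathrm{ld}\,f$ is the highest variable in $f$; if $d$ is the degree of $f$ in it, the rank of $f$ is $(\mathrm{ld}\,f)^d$, the initial of $f$ is the coefficient of $(\mathrm{ld}\,f)^d$, and the separant is $\partial f/\partial\,\mathrm{ld}\,f$. For a set $A$ of non-constant polynomials, $\mathrm{ld}\,A$ is its set of leaders, $H_A$ the set of initials and separants of its elements, and $H_A^\infty$ the multiplicative monoid generated by $H_A$. $A$ is algebraically autoreduced if $\deg_{\mathrm{ld}\,g}f<\deg_{\mathrm{ld}\,g}g$ for all distinct $f,g\in A$; it is (differentially) autoreduced if, in addition, no proper derivative of $\mathrm{ld}\,g$ appears in $f$; it is triangular if its elements have distinct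 leaders; it is weak d-triangular if moreover no leader of an element is a derivative of the leader of another element. Sets of polynomials with distinct leaders are compared by rank as usual: $A$ is lower than $B$ if the lowest rank that occurs in exactly one of the two sets occurs in $A$ (for finite sets this is the usual comparison of the increasing lists of ranks). A characteristic set of a differential ideal $I$ is an autoreduced subset of $I$ of the lowest rank; if moreover $I=[A]:H_A^\infty$ for such a set $A$, then $A$ is a characterizing set of $I$ and $I$ is characterizable. An algebraic characteristic (characterizing) set of an ideal $J$ of a polynomial ring $k[Z]$, $Z\subseteq\Theta Y$, is defined in the same way with algebraically autoreduced subsets of $J$ and $J=(A):H_A^\infty$ in $k[Z]$. A characterizing set $A$ is canonical if every $f\in A$ is monic (its lexicographically highest monomial has coefficient $1$), the initial of $f$ does not involve $\mathrm{ld}\,A$, and $f$ has no non-constant factor free of $\mathrm{ld}\,A$. A differential prolongation of a set $F$ of differential polynomials (or of derivatives) is a set $G$ with $F\subseteq G\subseteq\Theta F$ such that $\Theta F\setminus G$ is closed under all $\delta\in\Delta$. If $L=\mathrm{ld}\,C$ and $L\subseteq\bar L\subseteq\Theta L$, put $Z_{\bar L}=\bar L\cup(\Theta Y\setminus\Theta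 L)$; the ideal $\bar I_{\bar L}=I\cap k[Z_{\bar L}]$ of $k[Z_{\bar L}]$ is called the prolongation ideal of $I$. An autoreduced set $C$ is coherent if for all $f,g\in C$ whose leaders have a least common derivative $v=\theta\,\mathrm{ld}\,f=\theta'\,\mathrm{ld}\,g$, the polynomial $s_g\,\theta f-s_f\,\theta' g$ ($s_f,s_g$ the separants) lies in $(\{p\in\Theta C:\mathrm{ld}\,p<v\}):H_C^\infty$. An algebraic pseudo-remainder of $f$ with respect to a triangular set $B$ is a polynomial $\mathrm{algrem}(f,B)$ that is algebraically reduced with respect to every element of $B$ and is obtained from $f$ by finitely many pseudo-divisions by elements $b\in B$ (each viewed in the variable $\mathrm{ld}\,b$, and performed only when the dividend is not algebraically reduced with respect to $b$). (1) Let $C$ be a coherent autoreduced set, $D$ a differential prolongation of $C$, and $I=[C]:H_C^\infty$ with $1\notin I$. Then $I$ is prime if and only if the prolongation ideal $\bar I_{\mathrm{ld}\,D}$ is prime, and $I$ is characterizable if and only if $\bar I_{\mathrm{ld}\,D}$ is characterizable. (2) Let $C$ be a characteristic set of $I=[C]:H_C^\infty$ with $1\notin I$, and let $\bar L$ be a differential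 prolongation of $L=\mathrm{ld}\,C$. There are triangular subsets $B\subseteq\Theta C$ with $\mathrm{ld}\,B=\mathrm{ld}\,\Theta C$. For every such $B$, every $f\in B$ has an algebraic pseudo-remainder with respect to $B\setminus\{f\}$, and, for any choice of these pseudo-remainders, the set $$A=\{\mathrm{algrem}(f,B\setminus\{f\})\;:\;f\in B,\ \mathrm{ld}\,f\in\bar L\}$$ is contained in $k[Z_{\bar L}]$ and is a characterizing set of $\bar I_{\bar L}$. (3) Conversely, with $C$, $I$, $\bar L$ as in (2), let $A$ be a characterizing set of $\bar I_{\bar L}$ and let $T$ be a weak d-triangular subset of $A$ of the least rank. If $T$ is differentially autoreduced, then $T$ is a characterizing set of $I$. If $A$ is the canonical characteristic set of $\bar I_{\bar L}$, then $T$ is the canonical characteristic set of $I$. -/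

import Mathlib

namespace DiffAlg

section Algebraic

/-! ### Triangular sets in a polynomial ring whose variables are totally ordered -/

variable {σ : Type*} [LinearOrder σ] {k : Type*} [Field k]

/-- `u` is the leader of `f`: the highest variable appearing in `f`. Elements of the coefficient
field have no leader. -/
def IsLeader (f : MvPolynomial σ k) (u : σ) : Prop :=
  u ∈ f.vars ∧ ∀ v ∈ f.vars, v ≤ u

/-- The set of leaders of the elements of `A`. -/
def leaders (A : Set (MvPolynomial σ k)) : Set σ :=
  {u | ∃ f ∈ A, IsLeader f u}

/-- The coefficient of `u ^ d` in `f`, where `f` is seen as a univariate polynomial in `u`. -/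
noncomputable def coeffAt (u : σ) (d : ℕ) (f : MvPolynomial σ k) : MvPolynomial σ k :=
  ∑ s ∈ f.support with s u = d, MvPolynomial.monomial (s.erase u) (f.coeff s)

open Classical in
/-- The initial of `f`: the leading coefficient of `f` as a polynomial in its leader
(the value at a constant is irrelevant). -/
noncomputable def initial (f : MvPolynomial σ k) : MvPolynomial σ k :=
  if h : f.vars.Nonempty then coeffAt (f.vars.max' h) (f.degreeOf (f.vars.max' h)) f else f

open Classical in
/-- The separant of `f`: the partial derivative of `f` with respect to its leader
(the value at a constant is irrelevant). -/
noncomputable def separant (f : MvPolynomial σ k) : MvPolynomial σ k :=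
  if h : f.vars.Nonempty then MvPolynomial.pderiv (f.vars.max' h) f else 0

/-- `H_A`: the set of all initials and separants of elements of `A`. -/
def HSet (A : Set (MvPolynomial σ k)) : Set (MvPolynomial σ k) :=
  initial '' A ∪ separant '' A

/-- The saturation `I : H^∞`, where `H^∞` is the multiplicative monoid generated by `H`. -/
noncomputable def saturation {R : Type*} [CommRing R] (I : Ideal R) (H : Set R) : Ideal R where
  carrier := {a | ∃ s ∈ Submonoid.closure H, s * a ∈ I}
  zero_mem' := ⟨1, Submonoid.one_mem _, by simp⟩
  add_mem' := by
    rintro a b ⟨s, hs, hsa⟩ ⟨t, ht, htb⟩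
    refine ⟨s * t, Submonoid.mul_mem _ hs ht, ?_⟩
    have h : s * t * (a + b) = t * (s * a) + s * (t * b) := by ring
    rw [h]
    exact I.add_mem (I.mul_mem_left _ hsa) (I.mul_mem_left _ htb)
  smul_mem' := by
    rintro c a ⟨s, hs, hsa⟩
    refine ⟨s, hs, ?_⟩
    have h : s * (c • a) = c * (s * a) := by rw [smul_eq_mul]; ring
    rw [h]
    exact I.mul_mem_left _ hsa

/-- The set of ranks of the elements of `A`; the rank `u ^ d` of a polynomial with leader `u` and
degree `d` in `u` is encoded by the pair `(u, d)`, and ranks are ordered lexicographically. -/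
def rankSet (A : Set (MvPolynomial σ k)) : Set (σ ×ₗ ℕ) :=
  {r | ∃ f ∈ A, ∃ u, IsLeader f u ∧ r = toLex (u, f.degreeOf u)}

/-- `A` has lower rank than `B`, for sets whose elements have pairwise distinct ranks.
If `A` and `B` are listed in the order of increasing rank, then at the first place where the lists
of ranks differ either the rank in `A` is lower, or `B` has come to its end and `A` has not.
In other words, the lowest rank that occurs in exactly one of the two sets occurs in `A`;
in this form the comparison makes sense for infinite sets too. -/
def LowerRank (A B : Set (MvPolynomial σ k)) : Prop :=
  ∃ r ∈ rankSet A, r ∉ rankSet B ∧ ∀ s < r, (s ∈ rankSet A ↔ s ∈ rankSet B)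

/-- `f` is algebraically reduced with respect to `g`. -/
def AlgReduced (f g : MvPolynomial σ k) : Prop :=
  ∀ u, IsLeader g u → f.degreeOf u < g.degreeOf u

/-- `A` is an algebraically autoreduced set of non-constant polynomials. -/
def AlgAutoreduced (A : Set (MvPolynomial σ k)) : Prop :=
  (∀ f ∈ A, f.vars.Nonempty) ∧ ∀ f ∈ A, ∀ g ∈ A, f ≠ g → AlgReduced f g

/-- `A` is triangular: it consists of non-constant polynomials with pairwise distinct leaders. -/
def Triangular (A : Set (MvPolynomial σ k)) : Prop :=
  (∀ f ∈ A, f.vars.Nonempty) ∧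
    ∀ f ∈ A, ∀ g ∈ A, ∀ u, IsLeader f u → IsLeader g u → f = g

/-- `A` is an algebraic characteristic set of `J`: an algebraically autoreduced subset of `J` of
the lowest rank. -/
def IsAlgCharSet (J : Ideal (MvPolynomial σ k)) (A : Set (MvPolynomial σ k)) : Prop :=
  AlgAutoreduced A ∧ A ⊆ J ∧
    ∀ B : Set (MvPolynomial σ k), AlgAutoreduced B → B ⊆ J → ¬ LowerRank B A

/-- `A` characterizes the algebraic ideal `J`: it is an algebraic characteristic set of `J` and
`J = (A) : H_A^∞`. -/
def IsAlgCharacterizing (J : Ideal (MvPolynomial σ k)) (A : Set (MvPolynomial σ k)) : Prop :=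
  IsAlgCharSet J A ∧ J = saturation (Ideal.span A) (HSet A)

/-- `J` is a characterizable algebraic ideal. -/
def IsAlgCharacterizable (J : Ideal (MvPolynomial σ k)) : Prop :=
  ∃ A, IsAlgCharacterizing J A

/-- One pseudo-division: `f` is not algebraically reduced with respect to `b`, and `g` is a
pseudo-remainder of `f` modulo `b`, both seen as univariate polynomials in the leader of `b`. -/
def PseudoDivStep (b f g : MvPolynomial σ k) : Prop :=
  ∃ u, IsLeader b u ∧ b.degreeOf u ≤ f.degreeOf u ∧ g.degreeOf u < b.degreeOf u ∧
    ∃ (a : ℕ) (q : MvPolynomial σ k), initial b ^ a * f = q * b + g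

/-- `g` is an algebraic pseudo-remainder of `f` with respect to `B`: it is obtained from `f` by
finitely many pseudo-divisions by elements of `B` (in any order), and it is algebraically reduced
with respect to all elements of `B`. -/
def IsAlgRem (B : Set (MvPolynomial σ k)) (f g : MvPolynomial σ k) : Prop :=
  Relation.ReflTransGen (fun p q => ∃ b ∈ B, PseudoDivStep b p q) f g ∧
    ∀ b ∈ B, AlgReduced g b

/-- `f` is monic: the coefficient of its highest monomial is `1`, where monomials are ordered
lexicographically, starting from the highest variable. -/
def IsLexMonic (f : MvPolynomial σ k) : Prop :=
  ∃ s ∈ f.support, f.coeff s = 1 ∧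
    ∀ t ∈ f.support, t ≠ s → ∃ u, t u < s u ∧ ∀ v, u < v → t v = s v

/-- The normal form conditions in the definition of a canonical characteristic set: each element
of `A` is monic, its initial does not depend on the leaders of `A`, and it has no non-constant
factor that is free of the leaders of `A`. -/
def IsCanonicalForm (A : Set (MvPolynomial σ k)) : Prop :=
  ∀ f ∈ A, (∀ u ∈ leaders A, u ∉ (initial f).vars) ∧
    (∀ g, g ∣ f → (∀ u ∈ leaders A, u ∉ g.vars) → g.vars = ∅) ∧
    IsLexMonic f

end Algebraic

section Differential

/-! ### Differential polynomials -/

/-- The set `ΘY` of derivatives `θ y`, for `θ = δ_1 ^ (op 1) ⋯ δ_m ^ (op m)` and `y` one of the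
differential indeterminates `y_1, …, y_n`. -/
@[ext]
structure DVar (m n : ℕ) where
  /-- the exponents of the derivative operator -/
  op : Fin m →₀ ℕ
  /-- the index of the differential indeterminate -/
  var : Fin n

/-- The action of a derivative operator on a derivative. -/
noncomputable def DVar.act {m n : ℕ} (θ : Fin m →₀ ℕ) (u : DVar m n) : DVar m n :=
  ⟨θ + u.op, u.var⟩

/-- The total order on derivatives is a ranking. -/
def IsRanking (m n : ℕ) [LinearOrder (DVar m n)] : Prop :=
  (∀ (θ : Fin m →₀ ℕ) (u : DVar m n), u ≤ u.act θ) ∧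
    ∀ (θ : Fin m →₀ ℕ) (u v : DVar m n), v ≤ u → v.act θ ≤ u.act θ

/-- `Θ L` for a set `L` of derivatives. -/
def thetaVars {m n : ℕ} (L : Set (DVar m n)) : Set (DVar m n) :=
  {v | ∃ u ∈ L, ∃ θ, v = u.act θ}

/-- `L'` is a differential prolongation of the set `L` of derivatives:
`L ⊆ L' ⊆ Θ L`, and `Θ L \ L'` is closed under differentiation. -/
def IsVarProlongation {m n : ℕ} (L L' : Set (DVar m n)) : Prop :=
  L ⊆ L' ∧ L' ⊆ thetaVars L ∧
    ∀ u ∈ thetaVars L \ L', ∀ i, u.act (Finsupp.single i 1) ∈ thetaVars L \ L'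

/-- The set of variables `Z = L' ∪ (ΘY \ Θ L)`. -/
def prolongationVars {m n : ℕ} (L L' : Set (DVar m n)) : Set (DVar m n) :=
  L' ∪ (thetaVars L)ᶜ

variable {k : Type*} [Field k] {m n : ℕ}

/-- The derivation of a polynomial ring that applies a derivation `d` to the coefficients. -/
noncomputable def coeffDeriv {σ : Type*} (d : Derivation ℤ k k) :
    Derivation ℤ (MvPolynomial σ k) (MvPolynomial σ k) :=
  have hc : ∀ (p : MvPolynomial σ k) (s : σ →₀ ℕ),
      (∑ t ∈ p.support, MvPolynomial.monomial t (d (p.coeff t))).coeff s = d (p.coeff s) := by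
    classical
    intro p s
    rw [MvPolynomial.coeff_sum]
    simp only [MvPolynomial.coeff_monomial]
    rw [Finset.sum_ite_eq']
    split_ifs with h
    · rfl
    · rw [MvPolynomial.notMem_support_iff.mp h, map_zero]
  Derivation.mk'
    (AddMonoidHom.toIntLinearMap
      { toFun := fun p => ∑ t ∈ p.support, MvPolynomial.monomial t (d (p.coeff t))
        map_zero' := by simp
        map_add' := fun p q => by
          ext s
          rw [hc, MvPolynomial.coeff_add, MvPolynomial.coeff_add, hc, hc, map_add] })
    (fun p q => by
      classical
      ext s
      change (∑ t ∈ (p * q).support, MvPolynomial.monomial t (d ((p * q).coeff t))).coeff s =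
        (p * (∑ t ∈ q.support, MvPolynomial.monomial t (d (q.coeff t))) +
          q * (∑ t ∈ p.support, MvPolynomial.monomial t (d (p.coeff t)))).coeff s
      rw [hc, mul_comm q, MvPolynomial.coeff_add, MvPolynomial.coeff_mul, MvPolynomial.coeff_mul,
        MvPolynomial.coeff_mul, map_sum, ← Finset.sum_add_distrib]
      refine Finset.sum_congr rfl fun x _ => ?_
      rw [hc, hc, Derivation.leibniz, smul_eq_mul, smul_eq_mul]
      ring)

/-- The derivation `δ_i` on the ring `k{Y}` of differential polynomials: it extends the given
derivation of `k` and maps `θ y` to `δ_i θ y`. -/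
noncomputable def dpDeriv (δ : Fin m → Derivation ℤ k k) (i : Fin m) :
    Derivation ℤ (MvPolynomial (DVar m n) k) (MvPolynomial (DVar m n) k) :=
  coeffDeriv (δ i) + (MvPolynomial.mkDerivation k fun u : DVar m n =>
    (MvPolynomial.X (u.act (Finsupp.single i 1)) : MvPolynomial (DVar m n) k)).restrictScalars ℤ

/-- The derivative operator `θ = δ_1 ^ (θ 1) ⋯ δ_m ^ (θ m)` applied to `f`. -/
noncomputable def thetaOp (δ : Fin m → Derivation ℤ k k) (θ : Fin m →₀ ℕ)
    (f : MvPolynomial (DVar m n) k) : MvPolynomial (DVar m n) k :=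
  (List.finRange m).foldr (fun i g => (dpDeriv δ i)^[θ i] g) f

/-- `Θ F` for a set `F` of differential polynomials. -/
def thetaSet (δ : Fin m → Derivation ℤ k k) (F : Set (MvPolynomial (DVar m n) k)) :
    Set (MvPolynomial (DVar m n) k) :=
  {g | ∃ f ∈ F, ∃ θ, g = thetaOp δ θ f}

/-- `[F]`: the differential ideal generated by `F`, that is, the ideal generated by `Θ F`. -/
noncomputable def diffSpan (δ : Fin m → Derivation ℤ k k) (F : Set (MvPolynomial (DVar m n) k)) :
    Ideal (MvPolynomial (DVar m n) k) :=
  Ideal.span (thetaSet δ F)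

/-- `G` is a differential prolongation of `F`. -/
def IsProlongation (δ : Fin m → Derivation ℤ k k) (F G : Set (MvPolynomial (DVar m n) k)) : Prop :=
  F ⊆ G ∧ G ⊆ thetaSet δ F ∧
    ∀ f ∈ thetaSet δ F \ G, ∀ i, dpDeriv δ i f ∈ thetaSet δ F \ G

variable [LinearOrder (DVar m n)]

/-- `[A] : H_A^∞`. -/
noncomputable def satDiffIdeal (δ : Fin m → Derivation ℤ k k)
    (A : Set (MvPolynomial (DVar m n) k)) : Ideal (MvPolynomial (DVar m n) k) :=
  saturation (diffSpan δ A) (HSet A)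

/-- `f` is partially reduced with respect to `g`: no proper derivative of the leader of `g`
appears in `f`. -/
def PartiallyReduced (f g : MvPolynomial (DVar m n) k) : Prop :=
  ∀ u, IsLeader g u → ∀ θ, θ ≠ 0 → u.act θ ∉ f.vars

/-- `A` is a (differentially) autoreduced set of non-constant differential polynomials. -/
def Autoreduced (A : Set (MvPolynomial (DVar m n) k)) : Prop :=
  (∀ f ∈ A, f.vars.Nonempty) ∧
    ∀ f ∈ A, ∀ g ∈ A, f ≠ g → PartiallyReduced f g ∧ AlgReduced f g

/-- `A` is a weak d-triangular set: it consists of non-constant differential polynomials and no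
leader of an element is a (proper or improper) derivative of the leader of another element. -/
def WeakDTriangular (A : Set (MvPolynomial (DVar m n) k)) : Prop :=
  (∀ f ∈ A, f.vars.Nonempty) ∧
    ∀ f ∈ A, ∀ g ∈ A, f ≠ g → ∀ u v, IsLeader f u → IsLeader g v → ∀ θ, u ≠ v.act θ

/-- `C` is coherent: for all `f, g` in `C` with leaders `φ y` and `ψ y` and least common derivative
`v = θ φ y = θ' ψ y`, the Δ-polynomial `s_g θ f - s_f θ' g` lies in `(Θ C_{< v}) : H_C^∞`, where
`Θ C_{< v}` consists of all derivatives of elements of `C` with leader lower than `v`. -/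
def Coherent (δ : Fin m → Derivation ℤ k k) (C : Set (MvPolynomial (DVar m n) k)) : Prop :=
  ∀ f ∈ C, ∀ g ∈ C, ∀ u v, IsLeader f u → IsLeader g v → u.var = v.var →
    separant g * thetaOp δ (u.op ⊔ v.op - u.op) f - separant f * thetaOp δ (u.op ⊔ v.op - v.op) g ∈
      saturation
        (Ideal.span {p ∈ thetaSet δ C | ∃ w, IsLeader p w ∧ w < ⟨u.op ⊔ v.op, u.var⟩})
        (HSet C)

/-- `A` is a characteristic set of `I` in Kolchin's sense: an autoreduced subset of the lowest
rank. -/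
def IsDiffCharSet (I : Ideal (MvPolynomial (DVar m n) k)) (A : Set (MvPolynomial (DVar m n) k)) :
    Prop :=
  Autoreduced A ∧ A ⊆ I ∧
    ∀ B : Set (MvPolynomial (DVar m n) k), Autoreduced B → B ⊆ I → ¬ LowerRank B A

/-- `A` characterizes the differential ideal `I`: it is a characteristic set of `I` and
`I = [A] : H_A^∞`. -/
def IsDiffCharacterizing (δ : Fin m → Derivation ℤ k k) (I : Ideal (MvPolynomial (DVar m n) k))
    (A : Set (MvPolynomial (DVar m n) k)) : Prop :=
  IsDiffCharSet I A ∧ I = satDiffIdeal δ A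

/-- `I` is a characterizable differential ideal. -/
def IsDiffCharacterizable (δ : Fin m → Derivation ℤ k k)
    (I : Ideal (MvPolynomial (DVar m n) k)) : Prop :=
  ∃ A, IsDiffCharacterizing δ I A

/-- The ideal `I ∩ k[Z]` of the polynomial ring `k[Z]`, for a set `Z` of derivatives. The variables
of `k[Z]` are ordered as in `ΘY`. -/
noncomputable def restrictIdeal (I : Ideal (MvPolynomial (DVar m n) k)) (Z : Set (DVar m n)) :
    Ideal (MvPolynomial Z k) :=
  I.comap (MvPolynomial.rename (Subtype.val : Z → DVar m n))

/-- `A`, seen as a subset of `k{Y}`, for a subset `A` of `k[Z]`. -/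
def liftSet {Z : Set (DVar m n)} (A : Set (MvPolynomial Z k)) : Set (MvPolynomial (DVar m n) k) :=
  MvPolynomial.rename (Subtype.val : Z → DVar m n) '' A

/-- `T` is a weak d-triangular subset of `A` of the least rank. -/
def IsMinWeakDTriangular (A T : Set (MvPolynomial (DVar m n) k)) : Prop :=
  T ⊆ A ∧ WeakDTriangular T ∧
    ∀ T' : Set (MvPolynomial (DVar m n) k), T' ⊆ A → WeakDTriangular T' → ¬ LowerRank T' T

/-- `B` is a triangular subset of `Θ C` with the same set of leaders as `Θ C`. -/
def IsTriangularSection (δ : Fin m → Derivation ℤ k k) (C B : Set (MvPolynomial (DVar m n) k)) :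
    Prop :=
  B ⊆ thetaSet δ C ∧ Triangular B ∧ leaders B = leaders (thetaSet δ C)

end Differential

end DiffAlg

/-!
Let `I = [C] : H_C^∞` and let `B ⊆ Θ C` be triangular with `ld B = Θ (ld C)`. The initials and
separants of all elements of `Θ C` lie in `H_C`, so they are regular modulo `I`, and reducing
modulo `B` turns every `p` into some `g ≡ s p` modulo `[C]`, where `s` is a product of elements of
`H_C` and no proper derivative of `ld C` appears in `g`. Hence primality, and regularity modulo
the ideal, pass between `I` and `I ∩ k[Z]` as soon as `Z` contains the variables that are not proper
derivatives of `ld C`. Mutual pseudo-reduction of the elements of `B` preserves leaders, degrees and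
the regularity of initials.

An autoreduced subset of an ideal is a characteristic set if and only if every reduced element of
the ideal vanishes, and it is characterizing if and only if moreover its initials and separants are
regular. For coherent `C`, induction on the leader turns the conditions on the `Δ`-polynomials into
`I = (B) : H_C^∞`. If the leader `u` of some `p ∈ I` is not in `Θ (ld C)`, there is a derivation
that annihilates `B` and agrees with `∂/∂u` on the polynomials in the variables up to `u`; it shows
that all `∂^j p / ∂u^j` are in `I`, hence so is the initial of `p`. Consequently the leaders of a
characterizing set of the prolongation ideal lie in `Θ (ld C)`, and its weak d-triangular subset of
least rank consists of the elements whose leader is in `ld C`.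
-/

namespace DiffAlg

open MvPolynomial

section Univariate

/-! ### Polynomials seen as univariate polynomials in one variable -/

variable {σ : Type*} {k : Type*} [Field k]

open Classical in
/-- The polynomial `f` seen as a univariate polynomial in the variable `u`. The coefficients stay
in the ring of all polynomials, although `u` does not occur in them. -/
noncomputable def toUni (u : σ) : MvPolynomial σ k →ₐ[k] Polynomial (MvPolynomial σ k) :=
  aeval fun v => if v = u then Polynomial.X else Polynomial.C (X v)

theorem toUni_X_self (u : σ) : toUni (k := k) u (X u) = Polynomial.X := by simp [toUni]

theorem toUni_of_notMem {u : σ} {p : MvPolynomial σ k} (h : u ∉ p.vars) :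
    toUni u p = Polynomial.C p := by
  refine hom_congr_vars (f₁ := (toUni u).toRingHom) (f₂ := Polynomial.C) ?_ ?_ rfl
  · exact RingHom.ext fun a => (toUni u).commutes a
  · intro i hi _
    simp [toUni, ne_of_mem_of_not_mem hi h]

theorem eval_toUni (u : σ) (f : MvPolynomial σ k) : (toUni u f).eval (X u) = f := by
  have h : ((Polynomial.aeval (R := MvPolynomial σ k) (X u)).restrictScalars k).comp (toUni u) =
      AlgHom.id k (MvPolynomial σ k) := by
    ext v : 1
    by_cases hv : v = u
    · subst hv; simp [toUni]
    · simp [toUni, hv]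
  exact DFunLike.congr_fun h f

theorem toUni_injective (u : σ) : Function.Injective (toUni (k := k) u) :=
  Function.LeftInverse.injective (g := Polynomial.eval (X u)) (eval_toUni u)

theorem degreeOf_eq_zero_of_notMem {u : σ} {f : MvPolynomial σ k} (h : u ∉ f.vars) :
    f.degreeOf u = 0 :=
  not_not.1 (mt mem_vars_iff_degreeOf_ne_zero.2 h)

theorem vars_monomial_subset (s : σ →₀ ℕ) (a : k) :
    ((monomial s a).vars : Set σ) ⊆ s.support := by
  by_cases ha : a = 0
  · simp [ha]
  · rw [vars_monomial ha]

theorem toUni_monomial (u : σ) (s : σ →₀ ℕ) (a : k) :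
    toUni u (monomial s a) = Polynomial.monomial (s u) (monomial (s.erase u) a) := by
  have hsplit : (monomial s a : MvPolynomial σ k) = monomial (s.erase u) a * X u ^ s u := by
    rw [X_pow_eq_monomial, monomial_mul, mul_one, Finsupp.erase_add_single]
  have hu : u ∉ (monomial (s.erase u) a : MvPolynomial σ k).vars := fun h => by
    simpa using vars_monomial_subset _ _ h
  rw [hsplit, map_mul, map_pow, toUni_X_self, toUni_of_notMem hu,
    Polynomial.C_mul_X_pow_eq_monomial]

theorem coeff_toUni (u : σ) (f : MvPolynomial σ k) (d : ℕ) :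
    (toUni u f).coeff d = coeffAt u d f := by
  conv_lhs => rw [f.as_sum]
  rw [map_sum, Polynomial.finsetSum_coeff, coeffAt, Finset.sum_filter]
  refine Finset.sum_congr rfl fun s _ => ?_
  rw [toUni_monomial, Polynomial.coeff_monomial]

theorem coeffAt_mem_supported {S : Set σ} {f : MvPolynomial σ k} (hf : f ∈ supported k S) (u : σ)
    (d : ℕ) : coeffAt u d f ∈ supported k (S \ {u}) := by
  refine Subalgebra.sum_mem _ fun s hs => mem_supported.2 fun v hv => ?_
  classical
  have hv : v ∈ s.support ∧ v ≠ u := by simpa using vars_monomial_subset _ _ hv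
  have hs : s ∈ f.support := (Finset.mem_filter.1 hs).1
  exact ⟨mem_supported.1 hf ((mem_vars_iff_mem_support v).2
    ⟨s, hs, hv.1⟩), hv.2⟩

theorem notMem_vars_coeffAt (u : σ) (d : ℕ) (f : MvPolynomial σ k) : u ∉ (coeffAt u d f).vars :=
  fun hu => (mem_supported.1 (coeffAt_mem_supported f.mem_supported_vars u d) hu).2 rfl

theorem eq_sum_coeffAt (u : σ) (f : MvPolynomial σ k) :
    f = ∑ i ∈ Finset.range ((toUni u f).natDegree + 1), coeffAt u i f * X u ^ i := by
  conv_lhs => rw [← eval_toUni u f, Polynomial.eval_eq_sum_range]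
  simp only [coeff_toUni]

theorem natDegree_toUni (u : σ) (f : MvPolynomial σ k) :
    (toUni u f).natDegree = f.degreeOf u := by
  classical
  apply le_antisymm
  · refine Polynomial.natDegree_le_iff_coeff_eq_zero.2 fun j hj => ?_
    rw [coeff_toUni, coeffAt, Finset.sum_eq_zero]
    intro s hs
    obtain ⟨hs, hsj⟩ := Finset.mem_filter.1 hs
    exact absurd (monomial_le_degreeOf u hs) (by omega)
  · conv_lhs => rw [eq_sum_coeffAt u f]
    refine (degreeOf_sum_le _ _ _).trans (Finset.sup_le fun i hi => ?_)
    calc (coeffAt u i f * X u ^ i).degreeOf u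
        ≤ (coeffAt u i f).degreeOf u + (X u ^ i : MvPolynomial σ k).degreeOf u :=
          degreeOf_mul_le _ _ _
      _ ≤ 0 + i * (X u : MvPolynomial σ k).degreeOf u :=
          add_le_add (degreeOf_eq_zero_of_notMem (notMem_vars_coeffAt u i f)).le
            (degreeOf_pow_le _ _ _)
      _ = i := by rw [degreeOf_X, if_pos rfl, zero_add, mul_one]
      _ ≤ (toUni u f).natDegree := Nat.le_of_lt_succ (Finset.mem_range.1 hi)

theorem coeffAt_eq_zero_of_lt {u : σ} {f : MvPolynomial σ k} {d : ℕ} (h : f.degreeOf u < d) :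
    coeffAt u d f = 0 := by
  rw [← coeff_toUni]
  exact Polynomial.coeff_eq_zero_of_natDegree_lt (by rwa [natDegree_toUni])

theorem degreeOf_le_of_coeffAt_eq_zero {u : σ} {f : MvPolynomial σ k} {d : ℕ}
    (h : ∀ j, d < j → coeffAt u j f = 0) : f.degreeOf u ≤ d := by
  rw [← natDegree_toUni]
  exact Polynomial.natDegree_le_iff_coeff_eq_zero.2 fun j hj => (coeff_toUni u f j).trans (h j hj)

theorem coeffAt_degreeOf_ne_zero {u : σ} {f : MvPolynomial σ k} (hf : f ≠ 0) :
    coeffAt u (f.degreeOf u) f ≠ 0 := by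
  rw [← coeff_toUni, ← natDegree_toUni]
  exact Polynomial.leadingCoeff_ne_zero.2 ((map_ne_zero_iff _ (toUni_injective u)).2 hf)

theorem coeffAt_mul_of_notMem {u : σ} {a : MvPolynomial σ k} (ha : u ∉ a.vars)
    (f : MvPolynomial σ k) (d : ℕ) : coeffAt u d (a * f) = a * coeffAt u d f := by
  rw [← coeff_toUni, map_mul, toUni_of_notMem ha, Polynomial.coeff_C_mul, coeff_toUni]

theorem coeffAt_add (u : σ) (f g : MvPolynomial σ k) (d : ℕ) :
    coeffAt u d (f + g) = coeffAt u d f + coeffAt u d g := by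
  simp only [← coeff_toUni, map_add, Polynomial.coeff_add]

theorem degreeOf_coeffAt_le (u v : σ) (d : ℕ) (f : MvPolynomial σ k) :
    (coeffAt u d f).degreeOf v ≤ f.degreeOf v := by
  classical
  refine (degreeOf_sum_le _ _ _).trans (Finset.sup_le fun s hs => ?_)
  have hs : s ∈ f.support := (Finset.mem_filter.1 hs).1
  rw [degreeOf_monomial_eq _ _ (mem_support_iff.1 hs)]
  refine le_trans ?_ (monomial_le_degreeOf v hs)
  rw [Finsupp.erase_apply]
  split_ifs
  · exact Nat.zero_le _
  · exact le_rfl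

theorem toUni_pderiv (u : σ) (f : MvPolynomial σ k) :
    toUni u (pderiv u f) = Polynomial.derivative (toUni u f) := by
  induction f using MvPolynomial.induction_on' with
  | monomial s a =>
    have herase : (s - Finsupp.single u 1).erase u = s.erase u := by
      ext v
      by_cases hv : v = u
      · simp [hv]
      · simp [Finsupp.erase_ne hv, Ne.symm hv]
    rw [pderiv_monomial, toUni_monomial, toUni_monomial, Polynomial.derivative_monomial, herase]
    congr 1
    · simp
    · rw [← map_natCast C, mul_comm _ (C _), C_mul_monomial, mul_comm]
  | add p q hp hq => simp only [map_add, hp, hq]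

theorem pderiv_mem_supported {S : Set σ} {f : MvPolynomial σ k} (hf : f ∈ supported k S) (u : σ) :
    pderiv u f ∈ supported k S := by
  induction hf using Algebra.adjoin_induction with
  | mem x hx =>
    obtain ⟨v, -, rfl⟩ := hx
    classical
    rw [pderiv_X, Pi.single_apply]
    split_ifs
    exacts [one_mem _, zero_mem _]
  | algebraMap a => simp [algebraMap_eq]
  | add p q _ _ hp hq => simpa only [map_add] using add_mem hp hq
  | mul p q hp' hq' hp hq =>
    rw [Derivation.leibniz]
    exact add_mem (mul_mem hp' hq) (mul_mem hq' hp)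

theorem pderiv_of_degreeOf_eq_one {u : σ} {f : MvPolynomial σ k} (h : f.degreeOf u = 1) :
    pderiv u f = coeffAt u 1 f := by
  rw [← natDegree_toUni] at h
  rw [← eval_toUni u (pderiv u f), toUni_pderiv, Polynomial.eq_X_add_C_of_natDegree_le_one h.le]
  simp [coeff_toUni]

theorem toUni_iterate_pderiv (u : σ) (f : MvPolynomial σ k) (j : ℕ) :
    toUni u ((pderiv u)^[j] f) = Polynomial.derivative^[j] (toUni u f) :=
  Function.Semiconj.iterate_right (toUni_pderiv u) j f

theorem iterate_pderiv_degreeOf (u : σ) (f : MvPolynomial σ k) :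
    (pderiv u)^[f.degreeOf u] f = C ((f.degreeOf u).factorial : k) *
      coeffAt u (f.degreeOf u) f := by
  rw [← eval_toUni u ((pderiv u)^[_] f), toUni_iterate_pderiv, ← natDegree_toUni,
    Polynomial.eq_C_of_natDegree_le_zero
      ((Polynomial.natDegree_iterate_derivative _ _).trans (Nat.sub_self _).le),
    Polynomial.eval_C, Polynomial.coeff_iterate_derivative, zero_add, Nat.descFactorial_self,
    coeff_toUni, nsmul_eq_mul, map_natCast]

end Univariate

section Leader

/-! ### Leaders, initials and separants -/

variable {σ : Type*} [LinearOrder σ] {k : Type*} [Field k]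

theorem IsLeader.unique {f : MvPolynomial σ k} {u v : σ} (hu : IsLeader f u) (hv : IsLeader f v) :
    u = v := le_antisymm (hv.2 u hu.1) (hu.2 v hv.1)

theorem exists_isLeader {f : MvPolynomial σ k} (hf : f.vars.Nonempty) : ∃ u, IsLeader f u :=
  ⟨f.vars.max' hf, f.vars.max'_mem hf, f.vars.le_max'⟩

theorem IsLeader.nonempty {f : MvPolynomial σ k} {u : σ} (hu : IsLeader f u) : f.vars.Nonempty :=
  ⟨u, hu.1⟩

theorem IsLeader.max'_eq {f : MvPolynomial σ k} {u : σ} (hu : IsLeader f u) :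
    f.vars.max' hu.nonempty = u :=
  IsLeader.unique ⟨f.vars.max'_mem _, f.vars.le_max'⟩ hu

theorem IsLeader.initial_eq {f : MvPolynomial σ k} {u : σ} (hu : IsLeader f u) :
    initial f = coeffAt u (f.degreeOf u) f := by
  rw [initial, dif_pos hu.nonempty, hu.max'_eq]

theorem IsLeader.separant_eq {f : MvPolynomial σ k} {u : σ} (hu : IsLeader f u) :
    separant f = pderiv u f := by
  rw [separant, dif_pos hu.nonempty, hu.max'_eq]

theorem IsLeader.degreeOf_pos {f : MvPolynomial σ k} {u : σ} (hu : IsLeader f u) :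
    0 < f.degreeOf u := Nat.pos_of_ne_zero (mem_vars_iff_degreeOf_ne_zero.1 hu.1)

theorem IsLeader.ne_zero {f : MvPolynomial σ k} {u : σ} (hu : IsLeader f u) : f ≠ 0 := by
  rintro rfl
  simpa using hu.1

theorem IsLeader.mem_supported {f : MvPolynomial σ k} {u : σ} (hu : IsLeader f u) :
    f ∈ supported k (Set.Iic u) := MvPolynomial.mem_supported.2 hu.2

theorem isLeader_of_mem_supported {f : MvPolynomial σ k} {u : σ} (h : f ∈ supported k (Set.Iic u))
    (hd : f.degreeOf u ≠ 0) : IsLeader f u :=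
  ⟨mem_vars_iff_degreeOf_ne_zero.2 hd, fun _ hv => MvPolynomial.mem_supported.1 h hv⟩

theorem IsLeader.notMem_vars_of_lt {f : MvPolynomial σ k} {u v : σ} (hu : IsLeader f u)
    (h : u < v) : v ∉ f.vars := fun hv => (hu.2 v hv).not_gt h

theorem IsLeader.initial_ne_zero {f : MvPolynomial σ k} {u : σ} (hu : IsLeader f u) :
    initial f ≠ 0 := by
  rw [hu.initial_eq]
  exact coeffAt_degreeOf_ne_zero hu.ne_zero

theorem IsLeader.initial_mem_supported {f : MvPolynomial σ k} {u : σ} (hu : IsLeader f u) :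
    initial f ∈ supported k ((f.vars : Set σ) \ {u}) := by
  rw [hu.initial_eq]
  exact coeffAt_mem_supported f.mem_supported_vars u _

theorem IsLeader.notMem_vars_initial {f : MvPolynomial σ k} {u : σ} (hu : IsLeader f u) :
    u ∉ (initial f).vars := by
  rw [hu.initial_eq]
  exact notMem_vars_coeffAt _ _ _

theorem leaders_mono {A B : Set (MvPolynomial σ k)} (h : A ⊆ B) : leaders A ⊆ leaders B :=
  fun _ ⟨f, hf, hu⟩ => ⟨f, h hf, hu⟩

end Leader

section Regular

/-! ### Elements that are regular modulo an ideal -/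

variable {R : Type*} [CommRing R]

/-- The multiplicative monoid of the elements of `R` that are not zero divisors modulo `I`. -/
noncomputable def regularMod (I : Ideal R) : Submonoid R :=
  (nonZeroDivisors (R ⧸ I)).comap (Ideal.Quotient.mk I)

theorem mem_regularMod_iff {I : Ideal R} {h : R} :
    h ∈ regularMod I ↔ ∀ p, h * p ∈ I → p ∈ I := by
  simp only [regularMod, Submonoid.mem_comap, mem_nonZeroDivisors_iff_left,
    Ideal.Quotient.mk_surjective.forall, ← map_mul, Ideal.Quotient.eq_zero_iff_mem]

theorem mem_regularMod_of_sub_mem {I : Ideal R} {a b : R} (ha : a ∈ regularMod I)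
    (h : a - b ∈ I) : b ∈ regularMod I := by
  rw [regularMod, Submonoid.mem_comap] at ha ⊢
  rwa [← Ideal.Quotient.eq.2 h]

theorem notMem_of_mem_regularMod {I : Ideal R} {a : R} (ha : a ∈ regularMod I)
    (h1 : (1 : R) ∉ I) : a ∉ I :=
  fun h => h1 (mem_regularMod_iff.1 ha 1 (by rwa [mul_one]))

theorem subset_regularMod_saturation (I : Ideal R) (H : Set R) :
    H ⊆ regularMod (saturation I H) := by
  refine fun h hh => mem_regularMod_iff.2 ?_
  rintro p ⟨s, hs, hp⟩
  exact ⟨s * h, mul_mem hs (Submonoid.subset_closure hh), by rwa [mul_assoc]⟩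

theorem le_saturation (I : Ideal R) (H : Set R) : I ≤ saturation I H :=
  fun a ha => ⟨1, one_mem _, by rwa [one_mul]⟩

theorem saturation_le {I J : Ideal R} {H : Set R} (hI : I ≤ J) (hH : H ⊆ regularMod J) :
    saturation I H ≤ J := by
  rintro a ⟨s, hs, ha⟩
  exact mem_regularMod_iff.1 (Submonoid.closure_le.2 hH hs) a (hI ha)

theorem mem_iff_of_mul_sub_mem {I : Ideal R} {s a b : R} (hs : s ∈ regularMod I)
    (h : s * a - b ∈ I) : a ∈ I ↔ b ∈ I :=
  ⟨fun ha => (I.sub_mem_iff_right (I.mul_mem_left s ha)).1 h,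
    fun hb => mem_regularMod_iff.1 hs a ((I.sub_mem_iff_left hb).1 h)⟩

section Comap

variable {S F : Type*} [CommRing S] [FunLike F S R] [RingHomClass F S R] {φ : F} {I : Ideal R}
  (hφ : ∀ a, ∃ s ∈ regularMod I, ∃ b, s * a - φ b ∈ I)

include hφ

theorem map_mem_regularMod_iff {h : S} : φ h ∈ regularMod I ↔ h ∈ regularMod (I.comap φ) := by
  simp only [mem_regularMod_iff, Ideal.mem_comap, map_mul]
  refine ⟨fun hreg p => hreg (φ p), fun hreg a ha => ?_⟩
  obtain ⟨s, hs, b, hb⟩ := hφ a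
  refine (mem_iff_of_mul_sub_mem hs hb).2 (hreg b ((mem_iff_of_mul_sub_mem hs ?_).1 ha))
  rw [mul_left_comm, ← mul_sub]
  exact I.mul_mem_left _ hb

theorem isPrime_iff_comap : I.IsPrime ↔ (I.comap φ).IsPrime := by
  refine ⟨fun _ => Ideal.comap_isPrime φ I, fun hprime => ⟨?_, fun {a b} hab => ?_⟩⟩
  · rintro rfl
    exact hprime.ne_top Ideal.comap_top
  · obtain ⟨s, hs, f, hf⟩ := hφ a
    obtain ⟨t, ht, g, hg⟩ := hφ b
    rw [mem_iff_of_mul_sub_mem hs hf, mem_iff_of_mul_sub_mem ht hg]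
    refine hprime.mem_or_mem ?_
    rw [Ideal.mem_comap, map_mul]
    refine (mem_iff_of_mul_sub_mem (mul_mem hs ht) ?_).1 hab
    convert I.add_mem (I.mul_mem_left (t * b) hf) (I.mul_mem_left (φ f) hg) using 1
    ring

end Comap

end Regular

section PseudoDivision

/-! ### Pseudo-division -/

variable {σ : Type*} [LinearOrder σ] {k : Type*} [Field k]

theorem degreeOf_initial_mul_sub_lt {b f : MvPolynomial σ k} {u : σ} (hb : IsLeader b u)
    (h : b.degreeOf u ≤ f.degreeOf u) :
    (initial b * f - coeffAt u (f.degreeOf u) f * X u ^ (f.degreeOf u - b.degreeOf u) * b).degreeOf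
      u < f.degreeOf u := by
  have hpos : 0 < f.degreeOf u := hb.degreeOf_pos.trans_le h
  refine Nat.lt_of_le_pred hpos (degreeOf_le_of_coeffAt_eq_zero fun j hj => ?_)
  have hj : f.degreeOf u ≤ j := Nat.le_of_pred_lt hj
  rw [← coeff_toUni, map_sub, map_mul, map_mul, map_mul, map_pow, toUni_X_self,
    toUni_of_notMem hb.notMem_vars_initial, toUni_of_notMem (notMem_vars_coeffAt _ _ _),
    mul_assoc, Polynomial.coeff_sub, Polynomial.coeff_C_mul, Polynomial.coeff_C_mul,
    Polynomial.coeff_X_pow_mul', if_pos (by omega), coeff_toUni, coeff_toUni]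
  rcases hj.eq_or_lt with rfl | hj
  · rw [Nat.sub_sub_self h, ← hb.initial_eq, mul_comm, sub_self]
  · rw [coeffAt_eq_zero_of_lt (f := f) hj, coeffAt_eq_zero_of_lt (f := b) (by omega), mul_zero,
      mul_zero, sub_self]

theorem exists_initial_pow_mul_eq {b : MvPolynomial σ k} {u : σ} (hb : IsLeader b u)
    (f : MvPolynomial σ k) : ∃ (a : ℕ) (q g : MvPolynomial σ k),
      initial b ^ a * f = q * b + g ∧ g.degreeOf u < b.degreeOf u := by
  induction hd : f.degreeOf u using Nat.strong_induction_on generalizing f with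
  | _ d ih =>
    subst hd
    rcases lt_or_ge (f.degreeOf u) (b.degreeOf u) with h | h
    · exact ⟨0, 0, f, by ring, h⟩
    · obtain ⟨a, q, g, hq, hg⟩ := ih _ (degreeOf_initial_mul_sub_lt hb h) _ rfl
      refine ⟨a + 1, q + initial b ^ a * (coeffAt u (f.degreeOf u) f *
        X u ^ (f.degreeOf u - b.degreeOf u)), g, ?_, hg⟩
      linear_combination hq

theorem exists_pseudoDivStep {b f : MvPolynomial σ k} {u : σ} (hb : IsLeader b u)
    (h : b.degreeOf u ≤ f.degreeOf u) : ∃ g, PseudoDivStep b f g := by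
  obtain ⟨a, q, g, hq, hg⟩ := exists_initial_pow_mul_eq hb f
  exact ⟨g, u, hb, h, hg, a, q, hq⟩

omit [LinearOrder σ] in
theorem eq_zero_of_dvd_of_degreeOf_lt {b g : MvPolynomial σ k} {u : σ} (hbg : b ∣ g)
    (h : g.degreeOf u < b.degreeOf u) : g = 0 := by
  obtain ⟨q, rfl⟩ := hbg
  by_contra hne
  rw [degreeOf_mul_eq (left_ne_zero_of_mul hne) (right_ne_zero_of_mul hne)] at h
  omega

theorem PseudoDivStep.exists_dvd_coeffAt_sub {b f g : MvPolynomial σ k} (h : PseudoDivStep b f g)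
    {v : σ} (hv : v ∉ b.vars) :
    ∃ a : ℕ, ∀ j, b ∣ initial b ^ a * coeffAt v j f - coeffAt v j g := by
  obtain ⟨u, hu, -, -, a, q, hq⟩ := h
  refine ⟨a, fun j => ⟨coeffAt v j q, ?_⟩⟩
  have hi : v ∉ (initial b ^ a).vars := fun h =>
    hv (MvPolynomial.mem_supported.1 hu.initial_mem_supported (vars_pow _ _ h)).1
  rw [← coeffAt_mul_of_notMem hi, hq, coeffAt_add, add_sub_cancel_right, mul_comm q,
    coeffAt_mul_of_notMem hv]

theorem PseudoDivStep.coeffAt_eq_zero {b f g : MvPolynomial σ k} (h : PseudoDivStep b f g)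
    {v : σ} (hv : v ∉ b.vars) {j : ℕ} (hj : coeffAt v j f = 0) : coeffAt v j g = 0 := by
  obtain ⟨a, ha⟩ := h.exists_dvd_coeffAt_sub hv
  have hdvd := ha j
  rw [hj, mul_zero, zero_sub, dvd_neg] at hdvd
  obtain ⟨u, -, -, hlt, -⟩ := h
  exact eq_zero_of_dvd_of_degreeOf_lt hdvd ((degreeOf_coeffAt_le _ _ _ _).trans_lt hlt)

theorem PseudoDivStep.degreeOf_le {b f g : MvPolynomial σ k} (h : PseudoDivStep b f g) {v : σ}
    (hv : v ∉ b.vars) : g.degreeOf v ≤ f.degreeOf v :=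
  degreeOf_le_of_coeffAt_eq_zero fun _ hj => h.coeffAt_eq_zero hv (coeffAt_eq_zero_of_lt hj)

theorem PseudoDivStep.mem_supported {b f g : MvPolynomial σ k} (h : PseudoDivStep b f g)
    {S : Set σ} (hb : b ∈ supported k S) (hf : f ∈ supported k S) : g ∈ supported k S := by
  refine MvPolynomial.mem_supported.2 fun v hv => ?_
  by_contra hvS
  have hle := h.degreeOf_le fun h' => hvS (MvPolynomial.mem_supported.1 hb h')
  rw [degreeOf_eq_zero_of_notMem (f := f) fun h' => hvS (MvPolynomial.mem_supported.1 hf h')] at hle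
  exact mem_vars_iff_degreeOf_ne_zero.1 hv (Nat.le_zero.1 hle)

theorem PseudoDivStep.leader_mem_vars {b f g : MvPolynomial σ k} (h : PseudoDivStep b f g) {u : σ}
    (hu : IsLeader b u) : u ∈ f.vars := by
  obtain ⟨w, hw, hle, -⟩ := h
  obtain rfl := hw.unique hu
  exact mem_vars_iff_degreeOf_ne_zero.2 (hw.degreeOf_pos.trans_le hle).ne'

/-- `f` has rank `v ^ d`, and its initial is regular modulo `I`. This is what pseudo-divisions
preserve as long as the divisors have regular initials and do not lower the rank. -/
def HasRegularRank (I : Ideal (MvPolynomial σ k)) (v : σ) (d : ℕ) (f : MvPolynomial σ k) : Prop :=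
  IsLeader f v ∧ f.degreeOf v = d ∧ initial f ∈ regularMod I

theorem PseudoDivStep.hasRegularRank {I : Ideal (MvPolynomial σ k)} (h1 : 1 ∉ I)
    {b f g : MvPolynomial σ k} (h : PseudoDivStep b f g) (hbI : b ∈ I)
    (hb : initial b ∈ regularMod I) {v : σ} {d : ℕ} (hbv : IsLeader b v → d < b.degreeOf v)
    (hf : HasRegularRank I v d f) : HasRegularRank I v d g := by
  obtain ⟨hfv, rfl, hreg⟩ := hf
  obtain ⟨u, hu, hle, -⟩ := id h
  have huv : u < v := by
    refine lt_of_le_of_ne (hfv.2 u (h.leader_mem_vars hu)) ?_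
    rintro rfl
    exact (hbv hu).not_ge hle
  have hvb : v ∉ b.vars := hu.notMem_vars_of_lt huv
  have hcoeff : coeffAt v (f.degreeOf v) g ∈ regularMod I := by
    obtain ⟨a, ha⟩ := h.exists_dvd_coeffAt_sub hvb
    rw [hfv.initial_eq] at hreg
    exact mem_regularMod_of_sub_mem (mul_mem (pow_mem hb a) hreg) (I.mem_of_dvd (ha _) hbI)
  have hdeg : g.degreeOf v = f.degreeOf v := by
    refine (h.degreeOf_le hvb).antisymm (not_lt.1 fun hlt => ?_)
    rw [coeffAt_eq_zero_of_lt hlt] at hcoeff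
    exact notMem_of_mem_regularMod hcoeff h1 I.zero_mem
  have hgv : IsLeader g v := by
    refine isLeader_of_mem_supported (h.mem_supported ?_ hfv.mem_supported)
      (hdeg.trans_ne hfv.degreeOf_pos.ne')
    exact supported_mono (Set.Iic_subset_Iic.2 huv.le) hu.mem_supported
  refine ⟨hgv, hdeg, ?_⟩
  rwa [hgv.initial_eq, hdeg]

/-- `g` is obtained from `f` by finitely many pseudo-divisions by elements of `B`. -/
def PseudoReduces (B : Set (MvPolynomial σ k)) : MvPolynomial σ k → MvPolynomial σ k → Prop :=
  Relation.ReflTransGen fun p q => ∃ b ∈ B, PseudoDivStep b p q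

theorem PseudoReduces.mem_supported {B : Set (MvPolynomial σ k)} {S : Set σ}
    {f g : MvPolynomial σ k} (h : PseudoReduces B f g) (hB : ∀ b ∈ B, b ∈ supported k S)
    (hf : f ∈ supported k S) : g ∈ supported k S := by
  induction h with
  | refl => exact hf
  | tail _ h ih =>
    obtain ⟨b, hb, h⟩ := h
    exact h.mem_supported (hB b hb) ih

theorem PseudoReduces.exists_mul_sub_mem {B : Set (MvPolynomial σ k)} {f g : MvPolynomial σ k}
    (h : PseudoReduces B f g) :
    ∃ s ∈ Submonoid.closure (HSet B), s * f - g ∈ Ideal.span B := by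
  induction h with
  | refl => exact ⟨1, one_mem _, by simp⟩
  | tail _ h ih =>
    obtain ⟨b, hb, u, -, -, -, a, q, hq⟩ := h
    obtain ⟨s, hs, hsf⟩ := ih
    have hi : initial b ∈ Submonoid.closure (HSet B) :=
      Submonoid.subset_closure (Or.inl ⟨b, hb, rfl⟩)
    refine ⟨initial b ^ a * s, mul_mem (pow_mem hi a) hs, ?_⟩
    convert add_mem (Ideal.mul_mem_left _ (initial b ^ a) hsf)
      (Ideal.mul_mem_left _ q (Ideal.subset_span hb)) using 1
    linear_combination hq

theorem PseudoReduces.mem_of_mem {I : Ideal (MvPolynomial σ k)} {B : Set (MvPolynomial σ k)}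
    (hBI : B ⊆ I) {f g : MvPolynomial σ k} (h : PseudoReduces B f g) (hf : f ∈ I) : g ∈ I := by
  obtain ⟨s, -, hs⟩ := h.exists_mul_sub_mem
  exact (I.sub_mem_iff_right (I.mul_mem_left s hf)).1 (Ideal.span_le.2 hBI hs)

theorem PseudoReduces.hasRegularRank {I : Ideal (MvPolynomial σ k)} (h1 : 1 ∉ I)
    {B : Set (MvPolynomial σ k)} (hBI : B ⊆ I) (hB : initial '' B ⊆ regularMod I) {v : σ} {d : ℕ}
    (hBv : ∀ b ∈ B, IsLeader b v → d < b.degreeOf v) {f g : MvPolynomial σ k}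
    (h : PseudoReduces B f g) (hf : HasRegularRank I v d f) : HasRegularRank I v d g := by
  induction h with
  | refl => exact hf
  | tail _ h ih =>
    obtain ⟨b, hb, h⟩ := h
    exact h.hasRegularRank h1 (hBI hb) (hB ⟨b, hb, rfl⟩) (hBv b hb) ih

theorem PseudoReduces.exists_isLeader_of_zero {I : Ideal (MvPolynomial σ k)} (h1 : 1 ∉ I)
    {B : Set (MvPolynomial σ k)} (hBI : B ⊆ I) (hB : initial '' B ⊆ regularMod I)
    {f : MvPolynomial σ k} (h : PseudoReduces B f 0) {v : σ} (hv : IsLeader f v)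
    (hf : initial f ∈ regularMod I) : ∃ b ∈ B, IsLeader b v ∧ b.degreeOf v ≤ f.degreeOf v := by
  by_contra! hBv
  exact (h.hasRegularRank h1 hBI hB hBv ⟨hv, rfl, hf⟩).1.ne_zero rfl

theorem IsAlgRem.pseudoReduces {B : Set (MvPolynomial σ k)} {f g : MvPolynomial σ k}
    (h : IsAlgRem B f g) : PseudoReduces B f g := h.1

theorem IsAlgRem.eq_self {B : Set (MvPolynomial σ k)} {f g : MvPolynomial σ k}
    (h : IsAlgRem B f g) (hf : ∀ b ∈ B, AlgReduced f b) : g = f := by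
  rcases Relation.ReflTransGen.cases_head h.1 with h | ⟨_, ⟨b, hb, u, hu, hle, -⟩, -⟩
  · exact h.symm
  · exact absurd (hf b hb u hu) hle.not_gt

theorem Triangular.mono {A B : Set (MvPolynomial σ k)} (hB : Triangular B) (h : A ⊆ B) :
    Triangular A :=
  ⟨fun f hf => hB.1 f (h hf), fun f hf g hg => hB.2 f (h hf) g (h hg)⟩

/-- The leaders of the elements of `B` with respect to which `f` is not algebraically reduced. -/
def nonreducedLeaders (B : Set (MvPolynomial σ k)) (f : MvPolynomial σ k) : Set σ :=
  {u | ∃ b ∈ B, IsLeader b u ∧ b.degreeOf u ≤ f.degreeOf u}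

theorem finite_nonreducedLeaders (B : Set (MvPolynomial σ k)) (f : MvPolynomial σ k) :
    (nonreducedLeaders B f).Finite := by
  refine f.vars.finite_toSet.subset ?_
  rintro u ⟨b, -, hu, hle⟩
  exact mem_vars_iff_degreeOf_ne_zero.2 (hu.degreeOf_pos.trans_le hle).ne'

theorem algReduced_of_nonreducedLeaders_eq_empty {B : Set (MvPolynomial σ k)}
    {f : MvPolynomial σ k} (h : nonreducedLeaders B f = ∅) : ∀ b ∈ B, AlgReduced f b :=
  fun b hb _ hu => not_le.1 fun hle => h.le ⟨b, hb, hu, hle⟩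

theorem Triangular.exists_pseudoDivStep_of_isGreatest {B : Set (MvPolynomial σ k)}
    (hB : Triangular B) {f : MvPolynomial σ k} {w : σ}
    (hw : IsGreatest (nonreducedLeaders B f) w) :
    ∃ b ∈ B, ∃ g, PseudoDivStep b f g ∧ ∀ u ∈ nonreducedLeaders B g, u < w := by
  obtain ⟨⟨b, hb, hbw, hle⟩, hmax⟩ := hw
  obtain ⟨g, hg⟩ := exists_pseudoDivStep hbw hle
  refine ⟨b, hb, g, hg, ?_⟩
  rintro u ⟨c, hc, hcu, hcle⟩
  by_contra hwu
  rcases (not_lt.1 hwu).eq_or_lt with rfl | hwu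
  · obtain rfl := hB.2 b hb c hc _ hbw hcu
    obtain ⟨_, hu, -, hlt, -⟩ := hg
    obtain rfl := hu.unique hbw
    exact hlt.not_ge hcle
  · exact (hmax ⟨c, hc, hcu, hcle.trans (hg.degreeOf_le (hbw.notMem_vars_of_lt hwu))⟩).not_gt hwu

theorem Triangular.exists_isAlgRem [WellFoundedLT σ] {B : Set (MvPolynomial σ k)}
    (hB : Triangular B) (f : MvPolynomial σ k) : ∃ g, IsAlgRem B f g := by
  suffices h : ∀ (w : WithTop σ) (f : MvPolynomial σ k),
      (∀ u ∈ nonreducedLeaders B f, (u : WithTop σ) < w) → ∃ g, IsAlgRem B f g from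
    h ⊤ f fun u _ => WithTop.coe_lt_top u
  intro w
  induction w using WellFoundedLT.induction with
  | _ w ih =>
    intro f hf
    rcases (nonreducedLeaders B f).eq_empty_or_nonempty with hempty | hne
    · exact ⟨f, .refl, algReduced_of_nonreducedLeaders_eq_empty hempty⟩
    · obtain ⟨v, hv, hmax⟩ :=
        (nonreducedLeaders B f).exists_max_image id (finite_nonreducedLeaders B f) hne
      obtain ⟨b, hb, f', hstep, hlt⟩ := hB.exists_pseudoDivStep_of_isGreatest ⟨hv, hmax⟩
      obtain ⟨g, hg⟩ := ih v (hf v hv) f' fun u hu => WithTop.coe_lt_coe.2 (hlt u hu)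
      exact ⟨g, .head ⟨b, hb, hstep⟩ hg.1, hg.2⟩

end PseudoDivision

section CharacteristicSets

/-! ### Ranks and algebraic characteristic sets -/

variable {σ : Type*} [LinearOrder σ] {k : Type*} [Field k]

omit [LinearOrder σ] in
theorem vars_nonempty_of_mem {J : Ideal (MvPolynomial σ k)} (h1 : 1 ∉ J) {p : MvPolynomial σ k}
    (hp : p ∈ J) (hp0 : p ≠ 0) : p.vars.Nonempty := by
  rw [Finset.nonempty_iff_ne_empty, Ne, vars_eq_empty_iff_eq_C]
  intro hC
  have hc : p.coeff 0 ≠ 0 := fun h => hp0 (by rw [hC, h, C_0])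
  refine h1 ((Ideal.eq_top_iff_one J).1 (J.eq_top_of_isUnit_mem hp ?_))
  rw [hC]
  exact hc.isUnit.map C

theorem AlgAutoreduced.triangular {A : Set (MvPolynomial σ k)} (hA : AlgAutoreduced A) :
    Triangular A := by
  refine ⟨hA.1, fun f hf g hg u hfu hgu => ?_⟩
  by_contra hne
  exact lt_asymm (hA.2 f hf g hg hne u hgu) (hA.2 g hg f hf (Ne.symm hne) u hfu)

/-- The set that results from `A` when `p` is added and the elements whose leaders are not lower
than `u` are removed. For `u` the leader of a `p` that is reduced with respect to `A` it has lower
rank than `A`. -/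
def insertAt (A : Set (MvPolynomial σ k)) (u : σ) (p : MvPolynomial σ k) :
    Set (MvPolynomial σ k) :=
  insert p {a ∈ A | ∃ w, IsLeader a w ∧ w < u}

theorem insertAt_subset_insert (A : Set (MvPolynomial σ k)) (u : σ) (p : MvPolynomial σ k) :
    insertAt A u p ⊆ insert p A :=
  Set.insert_subset_insert (Set.sep_subset _ _)

theorem lowerRank_insertAt {A : Set (MvPolynomial σ k)} {p : MvPolynomial σ k} {u : σ}
    (hu : IsLeader p u) (hp : ∀ a ∈ A, AlgReduced p a) : LowerRank (insertAt A u p) A := by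
  refine ⟨toLex (u, p.degreeOf u), ⟨p, Or.inl rfl, u, hu, rfl⟩, ?_, fun s hs => ⟨?_, ?_⟩⟩
  · rintro ⟨a, ha, v, hv, h⟩
    obtain ⟨rfl, h⟩ := Prod.mk.inj (toLex.injective h)
    exact (hp a ha _ hv).ne h
  · rintro ⟨a, rfl | ha, v, hv, rfl⟩
    · obtain rfl := hv.unique hu
      exact absurd hs (lt_irrefl _)
    · exact ⟨a, ha.1, v, hv, rfl⟩
  · rintro ⟨a, ha, v, hv, rfl⟩
    rcases Prod.Lex.toLex_lt_toLex.1 hs with hs | ⟨rfl, hs⟩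
    · exact ⟨a, Or.inr ⟨ha, v, hv, hs⟩, v, hv, rfl⟩
    · exact absurd (hp a ha _ hv) hs.not_gt

theorem AlgAutoreduced.insertAt {A : Set (MvPolynomial σ k)} (hA : AlgAutoreduced A)
    {p : MvPolynomial σ k} {u : σ} (hu : IsLeader p u) (hp : ∀ a ∈ A, AlgReduced p a) :
    AlgAutoreduced (insertAt A u p) := by
  constructor
  · rintro f (rfl | hf)
    · exact hu.nonempty
    · exact hA.1 f hf.1
  · rintro f (rfl | hf) g (rfl | hg) hne
    · exact absurd rfl hne
    · exact hp g hg.1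
    · obtain ⟨-, w, hw, hlt⟩ := hf
      intro v hv
      obtain rfl := hv.unique hu
      rw [degreeOf_eq_zero_of_notMem (hw.notMem_vars_of_lt hlt)]
      exact hu.degreeOf_pos
    · exact hA.2 f hf.1 g hg.1 hne

theorem LowerRank.exists_algReduced {A B : Set (MvPolynomial σ k)} (hB : AlgAutoreduced B)
    (h : LowerRank B A) : ∃ p ∈ B, ∃ u, IsLeader p u ∧ (∀ a ∈ A, AlgReduced p a) ∧
      ∀ v ∈ leaders A, v < u → v ∈ leaders B := by
  obtain ⟨_, ⟨p, hp, u, hu, rfl⟩, hrA, hr⟩ := h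
  have hlower : ∀ a ∈ A, ∀ v, IsLeader a v → toLex (v, a.degreeOf v) < toLex (u, p.degreeOf u) →
      ∃ b ∈ B, IsLeader b v ∧ b.degreeOf v = a.degreeOf v := by
    intro a ha v hv hlt
    obtain ⟨b, hb, w, hw, h⟩ := (hr _ hlt).2 ⟨a, ha, v, hv, rfl⟩
    obtain ⟨rfl, h⟩ := Prod.mk.inj (toLex.injective h)
    exact ⟨b, hb, hw, h.symm⟩
  refine ⟨p, hp, u, hu, fun a ha v hv => ?_, ?_⟩
  · rcases lt_trichotomy (toLex (v, a.degreeOf v)) (toLex (u, p.degreeOf u)) with hlt | heq | hgt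
    · obtain ⟨b, hb, hbv, hd⟩ := hlower a ha v hv hlt
      have hne : p ≠ b := by
        rintro rfl
        obtain rfl := hbv.unique hu
        exact hlt.ne (by rw [hd])
      rw [← hd]
      exact hB.2 p hp b hb hne v hbv
    · exact absurd ⟨a, ha, v, hv, heq.symm⟩ hrA
    · rcases Prod.Lex.toLex_lt_toLex.1 hgt with hgt | ⟨rfl, hgt⟩
      · rw [degreeOf_eq_zero_of_notMem (hu.notMem_vars_of_lt hgt)]
        exact hv.degreeOf_pos
      · exact hgt
  · rintro v ⟨a, ha, hv⟩ hlt
    obtain ⟨b, hb, hbv, -⟩ := hlower a ha v hv (Prod.Lex.toLex_lt_toLex.2 (Or.inl hlt))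
    exact ⟨b, hb, hbv⟩

theorem rankSet_eq_or_lowerRank [WellFoundedLT σ] (A B : Set (MvPolynomial σ k)) :
    rankSet A = rankSet B ∨ LowerRank A B ∨ LowerRank B A := by
  by_contra! h
  obtain ⟨hne, hAB, hBA⟩ := h
  obtain ⟨r, hr, hmin⟩ := WellFounded.has_min (wellFounded_lt (α := σ ×ₗ ℕ))
    (symmDiff (rankSet A) (rankSet B)) (Set.nonempty_iff_ne_empty.2 (by simpa using hne))
  have hlow : ∀ s < r, (s ∈ rankSet A ↔ s ∈ rankSet B) := fun s hs => by
    have := hmin s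
    rw [Set.mem_symmDiff] at this
    tauto
  rcases hr with ⟨hrA, hrB⟩ | ⟨hrB, hrA⟩
  · exact hAB ⟨r, hrA, hrB, hlow⟩
  · exact hBA ⟨r, hrB, hrA, fun s hs => (hlow s hs).symm⟩

theorem Triangular.subset_of_rankSet_subset {A B D : Set (MvPolynomial σ k)} (hD : Triangular D)
    (hA : A ⊆ D) (hB : B ⊆ D) (h : rankSet A ⊆ rankSet B) : A ⊆ B := by
  intro f hf
  obtain ⟨u, hu⟩ := exists_isLeader (hD.1 f (hA hf))
  obtain ⟨g, hg, v, hv, huv⟩ := h ⟨f, hf, u, hu, rfl⟩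
  obtain ⟨rfl, -⟩ := Prod.mk.inj (toLex.injective huv)
  rwa [hD.2 f (hA hf) g (hB hg) u hu hv]

theorem isAlgCharSet_iff {J : Ideal (MvPolynomial σ k)} (h1 : 1 ∉ J)
    {A : Set (MvPolynomial σ k)} : IsAlgCharSet J A ↔
      AlgAutoreduced A ∧ A ⊆ J ∧ ∀ p ∈ J, (∀ a ∈ A, AlgReduced p a) → p = 0 := by
  refine and_congr_right fun hA => and_congr_right fun hAJ =>
    ⟨fun hmin p hp hred => ?_, fun hz B hB hBJ hlow => ?_⟩
  · by_contra hp0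
    obtain ⟨u, hu⟩ := exists_isLeader (vars_nonempty_of_mem h1 hp hp0)
    exact hmin _ (hA.insertAt hu hred)
      ((insertAt_subset_insert A u p).trans (Set.insert_subset hp hAJ)) (lowerRank_insertAt hu hred)
  · obtain ⟨p, hp, u, hu, hred, -⟩ := hlow.exists_algReduced hB
    exact hu.ne_zero (hz p (hBJ hp) hred)

theorem isAlgCharacterizing_iff [WellFoundedLT σ] {J : Ideal (MvPolynomial σ k)} (h1 : 1 ∉ J)
    {A : Set (MvPolynomial σ k)} :
    IsAlgCharacterizing J A ↔ IsAlgCharSet J A ∧ HSet A ⊆ regularMod J := by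
  refine and_congr_right fun hA => ⟨fun hJ => ?_, fun hreg => ?_⟩
  · rw [hJ]
    exact subset_regularMod_saturation _ _
  · obtain ⟨hauto, hAJ, hz⟩ := (isAlgCharSet_iff h1).1 hA
    refine le_antisymm (fun p hp => ?_) (saturation_le (Ideal.span_le.2 hAJ) hreg)
    obtain ⟨g, hg⟩ := hauto.triangular.exists_isAlgRem p
    obtain ⟨s, hs, hsp⟩ := hg.pseudoReduces.exists_mul_sub_mem
    rw [hz g (hg.pseudoReduces.mem_of_mem hAJ hp) hg.2, sub_zero] at hsp
    exact ⟨s, hs, hsp⟩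

end CharacteristicSets

section Rename

/-! ### Strictly monotone renaming of the variables -/

variable {τ σ : Type*} {k : Type*} [Field k] {φ : τ → σ}

theorem mem_vars_rename_iff (hφ : Function.Injective φ) {f : MvPolynomial τ k} {u : τ} :
    φ u ∈ (rename φ f).vars ↔ u ∈ f.vars := by
  rw [mem_vars_iff_degreeOf_ne_zero, mem_vars_iff_degreeOf_ne_zero,
    degreeOf_rename_of_injective hφ]

theorem vars_rename_nonempty_iff (hφ : Function.Injective φ) {f : MvPolynomial τ k} :
    (rename φ f).vars.Nonempty ↔ f.vars.Nonempty := by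
  constructor
  · rintro ⟨v, hv⟩
    obtain ⟨w, hw, -⟩ := mem_vars_rename _ _ hv
    exact ⟨w, hw⟩
  · rintro ⟨v, hv⟩
    exact ⟨φ v, (mem_vars_rename_iff hφ).2 hv⟩

theorem coeffAt_rename (hφ : Function.Injective φ) (u : τ) (d : ℕ) (f : MvPolynomial τ k) :
    coeffAt (φ u) d (rename φ f) = rename φ (coeffAt u d f) := by
  have h : (toUni (k := k) (φ u)).comp (rename φ) =
      (Polynomial.mapAlgHom (rename φ)).comp (toUni u) := by
    ext v : 1
    by_cases hv : v = u
    · subst hv; simp [toUni]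
    · simp [toUni, hv, hφ.ne hv]
  have := congr_arg (fun p => p.coeff d) (DFunLike.congr_fun h f)
  simpa [coeff_toUni] using this

theorem rename_val_mem_supported {Z : Set σ} (f : MvPolynomial Z k) :
    rename (Subtype.val : Z → σ) f ∈ supported k Z := by
  rw [supported_eq_range_rename]
  exact ⟨f, rfl⟩

theorem exists_rename_val_eq {Z : Set σ} {p : MvPolynomial σ k} (hp : p ∈ supported k Z) :
    ∃ f : MvPolynomial Z k, rename (Subtype.val : Z → σ) f = p := by
  rwa [supported_eq_range_rename] at hp

variable [LinearOrder τ] [LinearOrder σ] (hφ : StrictMono φ)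

include hφ

theorem isLeader_rename_iff {f : MvPolynomial τ k} {u : τ} :
    IsLeader (rename φ f) (φ u) ↔ IsLeader f u := by
  refine and_congr (mem_vars_rename_iff hφ.injective) ⟨fun h v hv => ?_, fun h v hv => ?_⟩
  · exact hφ.le_iff_le.1 (h _ ((mem_vars_rename_iff hφ.injective).2 hv))
  · obtain ⟨w, hw, rfl⟩ := mem_vars_rename _ _ hv
    exact hφ.monotone (h w hw)

theorem IsLeader.exists_of_rename {f : MvPolynomial τ k} {w : σ} (h : IsLeader (rename φ f) w) :
    ∃ u, φ u = w ∧ IsLeader f u := by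
  obtain ⟨u, -, rfl⟩ := mem_vars_rename _ _ h.1
  exact ⟨u, rfl, (isLeader_rename_iff hφ).1 h⟩

theorem initial_rename (f : MvPolynomial τ k) :
    initial (rename φ f) = rename φ (initial f) := by
  by_cases h : f.vars.Nonempty
  · obtain ⟨u, hu⟩ := exists_isLeader h
    rw [hu.initial_eq, ((isLeader_rename_iff hφ).2 hu).initial_eq, coeffAt_rename hφ.injective,
      degreeOf_rename_of_injective hφ.injective]
  · rw [initial, initial, dif_neg h, dif_neg (by rwa [vars_rename_nonempty_iff hφ.injective])]

theorem separant_rename (f : MvPolynomial τ k) :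
    separant (rename φ f) = rename φ (separant f) := by
  by_cases h : f.vars.Nonempty
  · obtain ⟨u, hu⟩ := exists_isLeader h
    rw [hu.separant_eq, ((isLeader_rename_iff hφ).2 hu).separant_eq,
      pderiv_rename hφ.injective]
  · rw [separant, separant, dif_neg h, dif_neg (by rwa [vars_rename_nonempty_iff hφ.injective]),
      map_zero]

theorem HSet_image_rename (A : Set (MvPolynomial τ k)) :
    HSet (rename φ '' A) = rename φ '' HSet A := by
  simp only [HSet, Set.image_union, Set.image_image, initial_rename hφ, separant_rename hφ]

theorem algReduced_rename_iff {f g : MvPolynomial τ k} :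
    AlgReduced (rename φ f) (rename φ g) ↔ AlgReduced f g := by
  have hdeg (p : MvPolynomial τ k) (u : τ) : (rename φ p).degreeOf (φ u) = p.degreeOf u :=
    degreeOf_rename_of_injective hφ.injective u
  constructor
  · intro h u hu
    simpa only [hdeg] using h (φ u) ((isLeader_rename_iff hφ).2 hu)
  · intro h w hw
    obtain ⟨u, rfl, hu⟩ := hw.exists_of_rename hφ
    simpa only [hdeg] using h u hu

theorem algAutoreduced_image_rename_iff {A : Set (MvPolynomial τ k)} :
    AlgAutoreduced (rename φ '' A) ↔ AlgAutoreduced A := by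
  simp only [AlgAutoreduced, Set.forall_mem_image, vars_rename_nonempty_iff hφ.injective,
    (rename_injective (R := k) φ hφ.injective).ne_iff, algReduced_rename_iff hφ]

theorem IsLexMonic.rename {f : MvPolynomial τ k} (h : IsLexMonic f) :
    IsLexMonic (MvPolynomial.rename φ f) := by
  classical
  obtain ⟨s, hs, hs1, hlex⟩ := h
  refine ⟨s.mapDomain φ, ?_, ?_, ?_⟩
  · rw [mem_support_iff, coeff_rename_mapDomain _ hφ.injective]
    exact mem_support_iff.1 hs
  · rw [coeff_rename_mapDomain _ hφ.injective, hs1]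
  · intro t ht hts
    rw [support_rename_of_injective hφ.injective, Finset.mem_image] at ht
    obtain ⟨t, ht, rfl⟩ := ht
    obtain ⟨u, hu, hv⟩ := hlex t ht (by rintro rfl; exact hts rfl)
    refine ⟨φ u, by simpa only [Finsupp.mapDomain_apply hφ.injective] using hu, fun v huv => ?_⟩
    by_cases hvφ : v ∈ Set.range φ
    · obtain ⟨w, rfl⟩ := hvφ
      simpa only [Finsupp.mapDomain_apply hφ.injective] using hv w (hφ.lt_iff_lt.1 huv)
    · rw [Finsupp.mapDomain_of_notMem_range _ _ hvφ, Finsupp.mapDomain_of_notMem_range _ _ hvφ]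

end Rename

section Restriction

/-! ### Characteristic sets of restricted ideals -/

variable {σ : Type*} [LinearOrder σ] {k : Type*} [Field k]

/-- `A` is an algebraic characteristic set of `I ∩ k[Z]`, seen as a subset of the ambient
polynomial ring. The minimality of the rank is replaced by the condition that no nonzero element
of `I ∩ k[Z]` is reduced with respect to `A`. -/
structure IsCharSetOn (I : Ideal (MvPolynomial σ k)) (Z : Set σ) (A : Set (MvPolynomial σ k)) :
    Prop where
  algAutoreduced : AlgAutoreduced A
  subset : A ⊆ I
  supported : A ⊆ supported k Z
  eq_zero_of_reduced : ∀ p ∈ I, p ∈ MvPolynomial.supported k Z →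
    (∀ a ∈ A, AlgReduced p a) → p = 0

/-- `A` is an algebraic characterizing set of `I ∩ k[Z]`, seen as a subset of the ambient
polynomial ring, provided that every polynomial becomes an element of `k[Z]` modulo `I` after
multiplication by an element that is regular modulo `I`. -/
structure IsCharacterizingOn (I : Ideal (MvPolynomial σ k)) (Z : Set σ)
    (A : Set (MvPolynomial σ k)) : Prop extends IsCharSetOn I Z A where
  HSet_subset : HSet A ⊆ regularMod I

variable {m n : ℕ} {Z : Set (DVar m n)} {I : Ideal (MvPolynomial (DVar m n) k)}

theorem liftSet_subset_supported (A : Set (MvPolynomial Z k)) : liftSet A ⊆ supported k Z :=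
  Set.image_subset_iff.2 fun a _ => rename_val_mem_supported a

theorem exists_liftSet_eq {A : Set (MvPolynomial (DVar m n) k)} (hA : A ⊆ supported k Z) :
    ∃ A' : Set (MvPolynomial Z k), liftSet A' = A :=
  ⟨_, Set.image_preimage_eq_of_subset fun _ ha => exists_rename_val_eq (hA ha)⟩

variable [LinearOrder (DVar m n)]

theorem isAlgCharSet_restrictIdeal_iff (h1 : 1 ∉ I) {A : Set (MvPolynomial Z k)} :
    IsAlgCharSet (restrictIdeal I Z) A ↔ IsCharSetOn I Z (liftSet A) := by
  have hval := Subtype.strictMono_coe Z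
  have hmem {p : MvPolynomial Z k} : p ∈ restrictIdeal I Z ↔ rename Subtype.val p ∈ I := Iff.rfl
  rw [isAlgCharSet_iff (by rwa [hmem, map_one])]
  constructor
  · rintro ⟨hA, hAI, hred⟩
    refine ⟨(algAutoreduced_image_rename_iff hval).2 hA, Set.image_subset_iff.2 hAI,
      liftSet_subset_supported A, fun p hp hpZ hpA => ?_⟩
    obtain ⟨p, rfl⟩ := exists_rename_val_eq hpZ
    rw [hred p hp fun a ha => (algReduced_rename_iff hval).1 (hpA _ ⟨a, ha, rfl⟩), map_zero]
  · intro h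
    refine ⟨(algAutoreduced_image_rename_iff hval).1 h.algAutoreduced,
      fun a ha => h.subset ⟨a, ha, rfl⟩, fun p hp hpA => ?_⟩
    refine rename_injective (R := k) _ Subtype.val_injective ?_
    rw [map_zero]
    exact h.eq_zero_of_reduced _ hp (rename_val_mem_supported p)
      (Set.forall_mem_image.2 fun a ha => (algReduced_rename_iff hval).2 (hpA a ha))

end Restriction

section Ranking

/-! ### Rankings -/

variable {m n : ℕ}

@[simp] theorem DVar.act_zero (u : DVar m n) : u.act 0 = u := by simp [DVar.act]

theorem DVar.act_act (u : DVar m n) (θ ψ : Fin m →₀ ℕ) : (u.act θ).act ψ = u.act (ψ + θ) := by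
  simp [DVar.act, add_assoc]

theorem DVar.act_injective (θ : Fin m →₀ ℕ) : Function.Injective (DVar.act (n := n) θ) := by
  intro u v h
  simp only [DVar.act, DVar.mk.injEq, add_right_inj] at h
  exact DVar.ext h.1 h.2

theorem DVar.act_eq_self_iff {u : DVar m n} {θ : Fin m →₀ ℕ} : u.act θ = u ↔ θ = 0 := by
  simp [DVar.ext_iff, DVar.act]

theorem finsuppNat_induction {ι : Type*} {P : (ι →₀ ℕ) → Prop} (zero : P 0)
    (add_single : ∀ θ i, P θ → P (θ + Finsupp.single i 1)) (θ : ι →₀ ℕ) : P θ := by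
  induction θ using Finsupp.induction with
  | zero => exact zero
  | single_add i d θ _ _ ih =>
    rw [add_comm]
    clear * - add_single ih
    induction d with
    | zero => rwa [Finsupp.single_zero, add_zero]
    | succ d hd => rw [Finsupp.single_add, ← add_assoc]; exact add_single _ _ hd

variable [LinearOrder (DVar m n)]

theorem IsRanking.lt_act (hr : IsRanking m n) {θ : Fin m →₀ ℕ} (hθ : θ ≠ 0) (u : DVar m n) :
    u < u.act θ :=
  lt_of_le_of_ne (hr.1 θ u) fun h => hθ (DVar.act_eq_self_iff.1 h.symm)

theorem IsRanking.act_lt_act (hr : IsRanking m n) (θ : Fin m →₀ ℕ) {u v : DVar m n} (h : u < v) :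
    u.act θ < v.act θ :=
  lt_of_le_of_ne (hr.2 θ v u h.le) fun e => h.ne (DVar.act_injective θ e)

theorem IsRanking.wellFoundedLT (hr : IsRanking m n) : WellFoundedLT (DVar m n) := by
  refine ⟨RelEmbedding.wellFounded_iff_isEmpty.2 ⟨fun f => ?_⟩⟩
  have hvar : WellQuasiOrdered fun a b : Fin n => a = b := Finite.wellQuasiOrdered _
  have hop : WellQuasiOrdered fun a b : Fin m →₀ ℕ => a ≤ b := wellQuasiOrdered_le
  obtain ⟨i, j, hij, h⟩ := (hvar.prod hop) fun i => ((f i).var, (f i).op)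
  have hlt : f j < f i := f.map_rel_iff.2 hij
  have hact : f j = (f i).act ((f j).op - (f i).op) :=
    DVar.ext (tsub_add_cancel_of_le h.2).symm h.1.symm
  rw [hact] at hlt
  exact (hr.1 _ _).not_gt hlt

end Ranking

section Derivations

/-! ### Derivative operators -/

variable {k : Type*} [Field k] {m n : ℕ} (δ : Fin m → Derivation ℤ k k)

theorem coeff_coeffDeriv {σ : Type*} (d : Derivation ℤ k k) (p : MvPolynomial σ k) (s : σ →₀ ℕ) :
    (coeffDeriv d p).coeff s = d (p.coeff s) := by
  classical
  change (∑ t ∈ p.support, monomial t (d (p.coeff t))).coeff s = d (p.coeff s)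
  simp only [coeff_sum, coeff_monomial]
  rw [Finset.sum_ite_eq']
  split_ifs with h
  · rfl
  · rw [notMem_support_iff.mp h, map_zero]

theorem dpDeriv_C (i : Fin m) (a : k) :
    dpDeriv δ i (C a : MvPolynomial (DVar m n) k) = C (δ i a) := by
  have h : coeffDeriv (δ i) (C a : MvPolynomial (DVar m n) k) = C (δ i a) := by
    classical
    ext s
    rw [coeff_coeffDeriv, coeff_C, coeff_C]
    split_ifs <;> simp
  rw [dpDeriv, Derivation.add_apply, h, Derivation.restrictScalars_apply, derivation_C, add_zero]

theorem dpDeriv_X (i : Fin m) (u : DVar m n) :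
    dpDeriv δ i (X u : MvPolynomial (DVar m n) k) = X (u.act (Finsupp.single i 1)) := by
  have h : coeffDeriv (δ i) (X u : MvPolynomial (DVar m n) k) = 0 := by
    classical
    ext s
    rw [coeff_coeffDeriv, coeff_X, coeff_zero]
    split_ifs <;> simp
  rw [dpDeriv, Derivation.add_apply, h, Derivation.restrictScalars_apply, mkDerivation_X, zero_add]

theorem dpDeriv_mul (i : Fin m) (f g : MvPolynomial (DVar m n) k) :
    dpDeriv δ i (f * g) = f * dpDeriv δ i g + g * dpDeriv δ i f := by
  rw [Derivation.leibniz, smul_eq_mul, smul_eq_mul]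

theorem dpDeriv_comm (hδ : ∀ i j a, δ i (δ j a) = δ j (δ i a)) (i j : Fin m)
    (f : MvPolynomial (DVar m n) k) :
    dpDeriv δ i (dpDeriv δ j f) = dpDeriv δ j (dpDeriv δ i f) := by
  induction f using MvPolynomial.induction_on with
  | C a => simp only [dpDeriv_C, hδ i j]
  | add p q hp hq => simp only [map_add, hp, hq]
  | mul_X p u hp =>
    simp only [dpDeriv_mul, dpDeriv_X, map_add, hp, DVar.act_act,
      add_comm (Finsupp.single i 1) (Finsupp.single j 1)]
    ring

theorem foldr_iterate_add_single {ι X : Type*} {D : ι → X → X}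
    (hD : ∀ i j, Function.Commute (D i) (D j)) (θ : ι →₀ ℕ) (x : X) {l : List ι} (hl : l.Nodup)
    {i : ι} (hi : i ∈ l) :
    l.foldr (fun j y => (D j)^[(θ + Finsupp.single i 1 : ι →₀ ℕ) j] y) x =
      D i (l.foldr (fun j y => (D j)^[θ j] y) x) := by
  have hne {j : ι} (hij : i ≠ j) : (θ + Finsupp.single i 1 : ι →₀ ℕ) j = θ j := by
    rw [Finsupp.add_apply, Finsupp.single_eq_of_ne' hij, add_zero]
  induction l with
  | nil => exact absurd hi List.not_mem_nil
  | cons j l ih =>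
    rw [List.nodup_cons] at hl
    rw [List.foldr_cons, List.foldr_cons]
    by_cases hij : i = j
    · subst hij
      rw [Finsupp.add_apply, Finsupp.single_eq_same, Function.iterate_succ_apply',
        List.foldr_ext _ _ _ fun j hj y => by rw [hne (ne_of_mem_of_not_mem hj hl.1).symm]]
    · rw [ih hl.2 ((List.mem_cons.1 hi).resolve_left hij), hne hij]
      exact (((hD i j).iterate_right (θ j)) _).symm

theorem thetaOp_zero (f : MvPolynomial (DVar m n) k) : thetaOp δ 0 f = f := by
  simp [thetaOp]

theorem thetaOp_add_single (hδ : ∀ i j a, δ i (δ j a) = δ j (δ i a)) (θ : Fin m →₀ ℕ) (i : Fin m)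
    (f : MvPolynomial (DVar m n) k) :
    thetaOp δ (θ + Finsupp.single i 1) f = dpDeriv δ i (thetaOp δ θ f) :=
  foldr_iterate_add_single (fun i j f => dpDeriv_comm δ hδ i j f) θ f (List.nodup_finRange m)
    (List.mem_finRange i)

theorem dpDeriv_mem_thetaSet (hδ : ∀ i j a, δ i (δ j a) = δ j (δ i a))
    {F : Set (MvPolynomial (DVar m n) k)} {f : MvPolynomial (DVar m n) k} (hf : f ∈ thetaSet δ F)
    (i : Fin m) : dpDeriv δ i f ∈ thetaSet δ F := by
  obtain ⟨g, hg, θ, rfl⟩ := hf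
  exact ⟨g, hg, _, (thetaOp_add_single δ hδ θ i g).symm⟩

theorem subset_thetaSet (F : Set (MvPolynomial (DVar m n) k)) : F ⊆ thetaSet δ F := fun f hf =>
  ⟨f, hf, 0, (thetaOp_zero δ f).symm⟩

theorem dpDeriv_mem_span {S T : Set (MvPolynomial (DVar m n) k)} (i : Fin m) (hST : S ⊆ T)
    (h : ∀ f ∈ S, dpDeriv δ i f ∈ Ideal.span T) {f : MvPolynomial (DVar m n) k}
    (hf : f ∈ Ideal.span S) : dpDeriv δ i f ∈ Ideal.span T := by
  induction hf using Submodule.span_induction with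
  | mem x hx => exact h x hx
  | zero => rw [map_zero]; exact Ideal.zero_mem _
  | add x y _ _ hx hy => rw [map_add]; exact Ideal.add_mem _ hx hy
  | smul a x hx' hx =>
    rw [smul_eq_mul, dpDeriv_mul]
    exact Ideal.add_mem _ (Ideal.mul_mem_left _ _ hx)
      (Ideal.mul_mem_right _ _ (Ideal.span_mono hST hx'))

theorem dpDeriv_mem_saturation {J J' : Ideal (MvPolynomial (DVar m n) k)}
    {H : Set (MvPolynomial (DVar m n) k)} (i : Fin m) (hJ : J ≤ J')
    (h : ∀ f ∈ J, dpDeriv δ i f ∈ J') {f : MvPolynomial (DVar m n) k} (hf : f ∈ saturation J H) :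
    dpDeriv δ i f ∈ saturation J' H := by
  obtain ⟨s, hs, hsf⟩ := hf
  have hδsf : s * dpDeriv δ i f + f * dpDeriv δ i s ∈ J' := by
    rw [← dpDeriv_mul]
    exact h _ hsf
  refine ⟨s * s, Submonoid.mul_mem _ hs hs, ?_⟩
  have heq : s * s * dpDeriv δ i f = s * (s * dpDeriv δ i f + f * dpDeriv δ i s) -
      dpDeriv δ i s * (s * f) := by ring
  rw [heq]
  exact J'.sub_mem (J'.mul_mem_left _ hδsf) (J'.mul_mem_left _ (hJ hsf))

theorem dpDeriv_mem_supported {S T : Set (DVar m n)} (i : Fin m) (hST : S ⊆ T)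
    (h : ∀ u ∈ S, u.act (Finsupp.single i 1) ∈ T) {f : MvPolynomial (DVar m n) k}
    (hf : f ∈ supported k S) : dpDeriv δ i f ∈ supported k T := by
  induction hf using Algebra.adjoin_induction with
  | mem x hx =>
    obtain ⟨u, hu, rfl⟩ := hx
    rw [dpDeriv_X]
    exact X_mem_supported.2 (h u hu)
  | algebraMap a => rw [algebraMap_eq, dpDeriv_C]; exact Subalgebra.algebraMap_mem _ _
  | add x y _ _ hx hy => rw [map_add]; exact Subalgebra.add_mem _ hx hy
  | mul x y hx' hy' hx hy =>
    rw [dpDeriv_mul]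
    exact Subalgebra.add_mem _ (Subalgebra.mul_mem _ (supported_mono hST hx') hy)
      (Subalgebra.mul_mem _ (supported_mono hST hy') hx)

variable [LinearOrder (DVar m n)]

theorem dpDeriv_mem_satDiffIdeal (hδ : ∀ i j a, δ i (δ j a) = δ j (δ i a))
    {A : Set (MvPolynomial (DVar m n) k)} {f : MvPolynomial (DVar m n) k}
    (hf : f ∈ satDiffIdeal δ A) (i : Fin m) : dpDeriv δ i f ∈ satDiffIdeal δ A :=
  dpDeriv_mem_saturation δ i le_rfl (fun _ hg => dpDeriv_mem_span δ i subset_rfl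
    (fun _ hg => Ideal.subset_span (dpDeriv_mem_thetaSet δ hδ hg i)) hg) hf

theorem thetaOp_mem_satDiffIdeal (hδ : ∀ i j a, δ i (δ j a) = δ j (δ i a))
    {A : Set (MvPolynomial (DVar m n) k)} {f : MvPolynomial (DVar m n) k}
    (hf : f ∈ satDiffIdeal δ A) (θ : Fin m →₀ ℕ) : thetaOp δ θ f ∈ satDiffIdeal δ A := by
  induction θ using finsuppNat_induction with
  | zero => rwa [thetaOp_zero]
  | add_single θ i ih =>
    rw [thetaOp_add_single δ hδ]
    exact dpDeriv_mem_satDiffIdeal δ hδ ih i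

theorem thetaSet_subset_satDiffIdeal (A : Set (MvPolynomial (DVar m n) k)) :
    thetaSet δ A ⊆ satDiffIdeal δ A := fun _ hf => le_saturation _ _ (Ideal.subset_span hf)

end Derivations

section LeadersOfDerivatives

/-! ### Leaders of derivatives -/

variable {σ : Type*} [LinearOrder σ] {k : Type*} [Field k]

section Linear

variable {s t : MvPolynomial σ k} {w : σ} (hs : s ∈ supported k (Set.Iio w))
  (ht : t ∈ supported k (Set.Iio w))

include hs ht

theorem toUni_mul_X_add :
    toUni w (s * X w + t) = Polynomial.C s * Polynomial.X + Polynomial.C t := by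
  have hw {p : MvPolynomial σ k} (hp : p ∈ supported k (Set.Iio w)) : w ∉ p.vars := fun h =>
    lt_irrefl w (mem_supported.1 hp h)
  rw [map_add, map_mul, toUni_X_self, toUni_of_notMem (hw hs), toUni_of_notMem (hw ht)]

theorem coeffAt_one_mul_X_add : coeffAt w 1 (s * X w + t) = s := by
  rw [← coeff_toUni, toUni_mul_X_add hs ht]
  simp

variable (hs0 : s ≠ 0)

include hs0

theorem degreeOf_mul_X_add : (s * X w + t).degreeOf w = 1 := by
  rw [← natDegree_toUni, toUni_mul_X_add hs ht, Polynomial.natDegree_linear hs0]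

theorem isLeader_mul_X_add : IsLeader (s * X w + t) w := by
  have hmono := supported_mono (R := k) (Set.Iio_subset_Iic_self (a := w))
  refine isLeader_of_mem_supported (Subalgebra.add_mem _
    (Subalgebra.mul_mem _ (hmono hs) (X_mem_supported.2 le_rfl)) (hmono ht)) ?_
  rw [degreeOf_mul_X_add hs ht hs0]
  exact one_ne_zero

theorem initial_mul_X_add : initial (s * X w + t) = s := by
  rw [(isLeader_mul_X_add hs ht hs0).initial_eq, degreeOf_mul_X_add hs ht hs0,
    coeffAt_one_mul_X_add hs ht]

theorem separant_mul_X_add : separant (s * X w + t) = s := by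
  rw [(isLeader_mul_X_add hs ht hs0).separant_eq,
    pderiv_of_degreeOf_eq_one (degreeOf_mul_X_add hs ht hs0), coeffAt_one_mul_X_add hs ht]

end Linear

theorem IsLeader.separant_mem_supported {f : MvPolynomial σ k} {u : σ}
    (hu : IsLeader f u) : separant f ∈ supported k (Set.Iic u) := by
  rw [hu.separant_eq]
  exact pderiv_mem_supported hu.mem_supported u

theorem IsLeader.separant_ne_zero [CharZero k] {f : MvPolynomial σ k}
    {u : σ} (hu : IsLeader f u) : separant f ≠ 0 := by
  intro h
  have hder : Polynomial.derivative (toUni u f) = 0 := by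
    rw [← toUni_pderiv, ← hu.separant_eq, h, map_zero]
  have hdeg := Polynomial.derivative_eq_zero.1 hder
  rw [natDegree_toUni] at hdeg
  exact hu.degreeOf_pos.ne' hdeg

variable {m n : ℕ} (δ : Fin m → Derivation ℤ k k) [LinearOrder (DVar m n)]

theorem exists_dpDeriv_eq (hr : IsRanking m n) (i : Fin m) {u : DVar m n}
    {f : MvPolynomial (DVar m n) k} (hf : f ∈ supported k (Set.Iic u)) :
    ∃ t ∈ supported k (Set.Iio (u.act (Finsupp.single i 1))),
      dpDeriv δ i f = pderiv u f * X (u.act (Finsupp.single i 1)) + t := by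
  have hlt : u < u.act (Finsupp.single i 1) := hr.lt_act (by simp) u
  have hmono : supported k (Set.Iic u) ≤ supported k (Set.Iio (u.act (Finsupp.single i 1))) :=
    supported_mono fun v hv => lt_of_le_of_lt hv hlt
  induction hf using Algebra.adjoin_induction with
  | mem x hx =>
    obtain ⟨v, hv, rfl⟩ := hx
    rcases (Set.mem_Iic.1 hv).eq_or_lt with rfl | hv
    · exact ⟨0, Subalgebra.zero_mem _, by rw [dpDeriv_X, pderiv_X_self, one_mul, add_zero]⟩
    · exact ⟨X (v.act _), X_mem_supported.2 (hr.act_lt_act _ hv),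
        by rw [dpDeriv_X, pderiv_X_of_ne hv.ne, zero_mul, zero_add]⟩
  | algebraMap a =>
    exact ⟨C (δ i a), Subalgebra.algebraMap_mem _ _,
      by rw [algebraMap_eq, dpDeriv_C, pderiv_C, zero_mul, zero_add]⟩
  | add x y _ _ hx hy =>
    obtain ⟨s, hs, hx⟩ := hx
    obtain ⟨t, ht, hy⟩ := hy
    exact ⟨s + t, Subalgebra.add_mem _ hs ht, by rw [map_add, map_add, hx, hy]; ring⟩
  | mul x y hx' hy' hx hy =>
    obtain ⟨s, hs, hx⟩ := hx
    obtain ⟨t, ht, hy⟩ := hy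
    exact ⟨x * t + y * s, Subalgebra.add_mem _ (Subalgebra.mul_mem _ (hmono hx') ht)
      (Subalgebra.mul_mem _ (hmono hy') hs), by rw [dpDeriv_mul, pderiv_mul, hx, hy]; ring⟩

theorem exists_dpDeriv_mul_X_add_eq (hr : IsRanking m n) (i : Fin m) {w : DVar m n}
    {s t : MvPolynomial (DVar m n) k} (hs : s ∈ supported k (Set.Iio w))
    (ht : t ∈ supported k (Set.Iio w)) :
    ∃ t' ∈ supported k (Set.Iio (w.act (Finsupp.single i 1))),
      dpDeriv δ i (s * X w + t) = s * X (w.act (Finsupp.single i 1)) + t' := by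
  have hlt : w < w.act (Finsupp.single i 1) := hr.lt_act (by simp) w
  have hderiv {p : MvPolynomial (DVar m n) k} (hp : p ∈ supported k (Set.Iio w)) :
      dpDeriv δ i p ∈ supported k (Set.Iio (w.act (Finsupp.single i 1))) :=
    dpDeriv_mem_supported δ i (Set.Iio_subset_Iio hlt.le) (fun _ hv => hr.act_lt_act _ hv) hp
  refine ⟨X w * dpDeriv δ i s + dpDeriv δ i t, Subalgebra.add_mem _
    (Subalgebra.mul_mem _ (X_mem_supported.2 hlt) (hderiv hs)) (hderiv ht), ?_⟩
  rw [map_add, dpDeriv_mul, dpDeriv_X]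
  ring

variable (hδ : ∀ i j a, δ i (δ j a) = δ j (δ i a)) (hr : IsRanking m n)
  {u : DVar m n} {f : MvPolynomial (DVar m n) k} (hu : IsLeader f u)

include hδ hr

include hu in
theorem exists_thetaOp_eq (θ : Fin m →₀ ℕ) (hθ : θ ≠ 0) :
    ∃ t ∈ supported k (Set.Iio (u.act θ)), thetaOp δ θ f = separant f * X (u.act θ) + t := by
  induction θ using finsuppNat_induction with
  | zero => exact absurd rfl hθ
  | add_single θ i ih =>
    have hact : u.act (θ + Finsupp.single i 1) = (u.act θ).act (Finsupp.single i 1) := by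
      rw [DVar.act_act, add_comm]
    rw [thetaOp_add_single δ hδ, hact]
    by_cases hθ : θ = 0
    · subst hθ
      rw [thetaOp_zero, DVar.act_zero, hu.separant_eq]
      exact exists_dpDeriv_eq δ hr i hu.mem_supported
    · obtain ⟨t, ht, heq⟩ := ih hθ
      rw [heq]
      exact exists_dpDeriv_mul_X_add_eq δ hr i
        (supported_mono (Set.Iic_subset_Iio.2 (hr.lt_act hθ u)) hu.separant_mem_supported) ht

variable [CharZero k]

section NonzeroOperator

variable {θ : Fin m →₀ ℕ} (hθ : θ ≠ 0)

include hu hθ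

theorem degreeOf_thetaOp : (thetaOp δ θ f).degreeOf (u.act θ) = 1 := by
  obtain ⟨t, ht, heq⟩ := exists_thetaOp_eq δ hδ hr hu θ hθ
  rw [heq]
  exact degreeOf_mul_X_add (supported_mono (Set.Iic_subset_Iio.2 (hr.lt_act hθ u))
    hu.separant_mem_supported) ht hu.separant_ne_zero

theorem initial_thetaOp : initial (thetaOp δ θ f) = separant f := by
  obtain ⟨t, ht, heq⟩ := exists_thetaOp_eq δ hδ hr hu θ hθ
  rw [heq]
  exact initial_mul_X_add (supported_mono (Set.Iic_subset_Iio.2 (hr.lt_act hθ u))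
    hu.separant_mem_supported) ht hu.separant_ne_zero

theorem separant_thetaOp : separant (thetaOp δ θ f) = separant f := by
  obtain ⟨t, ht, heq⟩ := exists_thetaOp_eq δ hδ hr hu θ hθ
  rw [heq]
  exact separant_mul_X_add (supported_mono (Set.Iic_subset_Iio.2 (hr.lt_act hθ u))
    hu.separant_mem_supported) ht hu.separant_ne_zero

end NonzeroOperator

include hu in
theorem IsLeader.thetaOp (θ : Fin m →₀ ℕ) : IsLeader (thetaOp δ θ f) (u.act θ) := by
  by_cases hθ : θ = 0
  · subst hθ
    rwa [thetaOp_zero, DVar.act_zero]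
  · obtain ⟨t, ht, heq⟩ := exists_thetaOp_eq δ hδ hr hu θ hθ
    rw [heq]
    exact isLeader_mul_X_add (supported_mono (Set.Iic_subset_Iio.2 (hr.lt_act hθ u))
      hu.separant_mem_supported) ht hu.separant_ne_zero

variable {F : Set (MvPolynomial (DVar m n) k)} (hF : ∀ f ∈ F, f.vars.Nonempty)

include hF

theorem HSet_thetaSet_subset : HSet (thetaSet δ F) ⊆ HSet F := by
  rintro _ (⟨_, ⟨f, hf, θ, rfl⟩, rfl⟩ | ⟨_, ⟨f, hf, θ, rfl⟩, rfl⟩) <;>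
    obtain ⟨u, hu⟩ := exists_isLeader (hF f hf) <;> by_cases hθ : θ = 0
  · exact Or.inl ⟨f, hf, by rw [hθ, thetaOp_zero]⟩
  · exact Or.inr ⟨f, hf, (initial_thetaOp δ hδ hr hu hθ).symm⟩
  · exact Or.inr ⟨f, hf, by rw [hθ, thetaOp_zero]⟩
  · exact Or.inr ⟨f, hf, (separant_thetaOp δ hδ hr hu hθ).symm⟩

theorem leaders_thetaSet : leaders (thetaSet δ F) = thetaVars (leaders F) := by
  ext v
  constructor
  · rintro ⟨_, ⟨f, hf, θ, rfl⟩, hv⟩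
    obtain ⟨u, hu⟩ := exists_isLeader (hF f hf)
    exact ⟨u, ⟨f, hf, hu⟩, θ, hv.unique (hu.thetaOp δ hδ hr θ)⟩
  · rintro ⟨u, ⟨f, hf, hu⟩, θ, rfl⟩
    exact ⟨_, ⟨f, hf, θ, rfl⟩, hu.thetaOp δ hδ hr θ⟩

end LeadersOfDerivatives

section Tangent

/-! ### Vector fields tangent to a triangular set -/

variable {σ : Type*} [LinearOrder σ] {k : Type*} [Field k]

theorem exists_eq_indicator_Iio [WellFoundedLT σ] {M : Type*} [Zero M] (F : σ → (σ → M) → M) :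
    ∃ e : σ → M, ∀ w, e w = F w ((Set.Iio w).indicator e) := by
  classical
  let G : ∀ w : σ, (∀ x, x < w → M) → M := fun w e => F w fun x => if hx : x < w then e x hx else 0
  refine ⟨WellFounded.fix (wellFounded_lt (α := σ)) G, fun w => ?_⟩
  rw [WellFounded.fix_eq]
  refine congr_arg (F w) (funext fun x => ?_)
  by_cases hx : x < w <;> simp [Set.indicator, hx]

theorem mkDerivation_eq_indicator_add {M : Type*} [AddCommGroup M] [Module k M]
    [Module (MvPolynomial σ k) M] [IsScalarTower k (MvPolynomial σ k) M] (e : σ → M) {w : σ}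
    {f : MvPolynomial σ k} (hf : f ∈ supported k (Set.Iic w)) :
    mkDerivation k e f = mkDerivation k ((Set.Iio w).indicator e) f + pderiv w f • e w := by
  refine derivation_eq_of_forall_mem_vars (D₁ := mkDerivation k e)
    (D₂ := mkDerivation k ((Set.Iio w).indicator e) +
      (LinearMap.toSpanSingleton (MvPolynomial σ k) M (e w)).compDer (pderiv w)) fun x hx => ?_
  rw [Derivation.add_apply, mkDerivation_X, mkDerivation_X]
  rcases (Set.mem_Iic.1 (mem_supported.1 hf hx)).eq_or_lt with rfl | hlt
  · simp [LinearMap.toSpanSingleton_apply]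
  · simp [LinearMap.toSpanSingleton_apply, pderiv_X_of_ne hlt.ne, hlt]

theorem Triangular.exists_forall_isLeader_eq {B : Set (MvPolynomial σ k)} (hB : Triangular B) :
    ∃ r : σ → MvPolynomial σ k, ∀ b ∈ B, ∀ w, IsLeader b w → r w = b := by
  have h (w : σ) : ∃ r : MvPolynomial σ k, ∀ b ∈ B, IsLeader b w → r = b := by
    by_cases hw : w ∈ leaders B
    · obtain ⟨r, hr, hrw⟩ := hw
      exact ⟨r, fun b hb hbw => hB.2 r hr b hb w hrw hbw⟩
    · exact ⟨0, fun b hb hbw => absurd ⟨b, hb, hbw⟩ hw⟩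
  choose r hr using h
  exact ⟨r, fun b hb w => hr w b hb⟩

/-- The vector field `D` is built coordinate by coordinate: at the leader `w` of some `b ∈ B`, the
equation `D b = 0` can be solved for `D (X w)`, because the separant of `b` is invertible. -/
theorem Triangular.exists_derivation [WellFoundedLT σ] {B : Set (MvPolynomial σ k)}
    (hB : Triangular B) {R : Type*} [CommRing R] [Algebra k R] [Algebra (MvPolynomial σ k) R]
    [IsScalarTower k (MvPolynomial σ k) R]
    (hsep : ∀ b ∈ B, IsUnit (algebraMap (MvPolynomial σ k) R (separant b)))
    {u : σ} (hu : u ∉ leaders B) :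
    ∃ D : Derivation k (MvPolynomial σ k) R, (∀ b ∈ B, D b = 0) ∧
      ∀ f ∈ supported k (Set.Iic u), D f = algebraMap _ _ (pderiv u f) := by
  classical
  obtain ⟨r, hr⟩ := hB.exists_forall_isLeader_eq
  obtain ⟨e, he⟩ := exists_eq_indicator_Iio fun (w : σ) (e' : σ → R) => if w = u then 1 else
    -(Ring.inverse (algebraMap (MvPolynomial σ k) R (separant (r w))) * mkDerivation k e' (r w))
  have hzero : mkDerivation k (0 : σ → R) = 0 := derivation_ext fun i => mkDerivation_X k _ i
  have hlow (w : σ) : w ≤ u → (Set.Iio w).indicator e = 0 := by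
    induction w using WellFoundedLT.induction with
    | ind w ih =>
      refine fun hwu => Set.indicator_eq_zero'.2 (Set.disjoint_left.2 fun x hx hxw => hx ?_)
      have hxu : x < u := (Set.mem_Iio.1 hxw).trans_le hwu
      rw [he x, if_neg hxu.ne, ih x hxw hxu.le, hzero, Derivation.zero_apply, mul_zero, neg_zero]
  refine ⟨mkDerivation k e, fun b hb => ?_, fun f hf => ?_⟩
  · obtain ⟨w, hw⟩ := exists_isLeader (hB.1 b hb)
    have hwu : w ≠ u := by
      rintro rfl
      exact hu ⟨b, hb, hw⟩
    rw [mkDerivation_eq_indicator_add e hw.mem_supported, he w, if_neg hwu, hr b hb w hw,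
      ← hw.separant_eq, Algebra.smul_def, mul_neg, ← mul_assoc,
      Ring.mul_inverse_cancel _ (hsep b hb), one_mul, add_neg_cancel]
  · rw [mkDerivation_eq_indicator_add e hf, hlow u le_rfl, hzero, Derivation.zero_apply, zero_add,
      he u, if_pos rfl, Algebra.smul_def, mul_one]

theorem Triangular.pderiv_mem_saturation [WellFoundedLT σ] {B : Set (MvPolynomial σ k)}
    (hB : Triangular B) {H : Set (MvPolynomial σ k)} (hH : ∀ b ∈ B, separant b ∈ H) {u : σ}
    (hu : u ∉ leaders B) {f : MvPolynomial σ k} (hf : f ∈ saturation (Ideal.span B) H)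
    (hfu : f ∈ supported k (Set.Iic u)) : pderiv u f ∈ saturation (Ideal.span B) H := by
  let M := Submonoid.closure H
  obtain ⟨D, hDB, hDu⟩ := hB.exists_derivation (R := Localization M)
    (fun b hb => IsLocalization.map_units _ (⟨_, Submonoid.subset_closure (hH b hb)⟩ : M)) hu
  set J := (Ideal.span B).map (algebraMap (MvPolynomial σ k) (Localization M))
  have hDJ (p : MvPolynomial σ k) (hp : p ∈ Ideal.span B) : D p ∈ J := by
    induction hp using Submodule.span_induction with
    | mem x hx => rw [hDB x hx]; exact J.zero_mem
    | zero => rw [map_zero]; exact J.zero_mem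
    | add x y _ _ hx hy => rw [map_add]; exact J.add_mem hx hy
    | smul a x hx' hx =>
      rw [smul_eq_mul, Derivation.leibniz, Algebra.smul_def, Algebra.smul_def]
      exact J.add_mem (J.mul_mem_left _ hx) (J.mul_mem_right _ (Ideal.mem_map_of_mem _ hx'))
  obtain ⟨s, hs, hsf⟩ := hf
  have hfJ : algebraMap (MvPolynomial σ k) (Localization M) f ∈ J :=
    (IsLocalization.algebraMap_mem_map_algebraMap_iff M _ _ _).2 ⟨s, hs, hsf⟩
  have hDsf := hDJ _ hsf
  rw [Derivation.leibniz, hDu f hfu, Algebra.smul_def, Algebra.smul_def,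
    J.add_mem_iff_left (J.mul_mem_right _ hfJ), ← map_mul,
    IsLocalization.algebraMap_mem_map_algebraMap_iff M] at hDsf
  obtain ⟨t, ht, htsf⟩ := hDsf
  exact ⟨t * s, Submonoid.mul_mem _ ht hs, by rwa [mul_assoc]⟩

theorem Triangular.initial_mem_saturation [WellFoundedLT σ] [CharZero k]
    {B : Set (MvPolynomial σ k)} (hB : Triangular B) {H : Set (MvPolynomial σ k)}
    (hH : ∀ b ∈ B, separant b ∈ H) {u : σ} (hu : u ∉ leaders B) {f : MvPolynomial σ k}
    (hf : f ∈ saturation (Ideal.span B) H) (hfu : IsLeader f u) :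
    initial f ∈ saturation (Ideal.span B) H := by
  have hiter (j : ℕ) : (pderiv u)^[j] f ∈ saturation (Ideal.span B) H ∧
      (pderiv u)^[j] f ∈ supported k (Set.Iic u) := by
    induction j with
    | zero => exact ⟨hf, hfu.mem_supported⟩
    | succ j ih =>
      rw [Function.iterate_succ_apply']
      exact ⟨hB.pderiv_mem_saturation hH hu ih.1 ih.2, pderiv_mem_supported ih.2 u⟩
  have hmem := (hiter (f.degreeOf u)).1
  rw [iterate_pderiv_degreeOf, ← hfu.initial_eq] at hmem
  have hd : ((f.degreeOf u).factorial : k) ≠ 0 := by exact_mod_cast Nat.factorial_ne_zero _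
  have hinit := Ideal.mul_mem_left _ (C (((f.degreeOf u).factorial : k)⁻¹)) hmem
  rwa [← mul_assoc, ← C_mul, inv_mul_cancel₀ hd, C_1, one_mul] at hinit

end Tangent

section Coherence

/-! ### Coherence and triangular sections -/

variable {k : Type*} [Field k] {m n : ℕ} (δ : Fin m → Derivation ℤ k k)

/-- The `Δ`-polynomial `s_g θ f - s_f ψ g`, for derivative operators `θ` and `ψ` that map the
leaders of `f` and `g` to a common, not necessarily least, derivative. -/
noncomputable def deltaPoly [LinearOrder (DVar m n)] (f g : MvPolynomial (DVar m n) k)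
    (θ ψ : Fin m →₀ ℕ) : MvPolynomial (DVar m n) k :=
  separant g * thetaOp δ θ f - separant f * thetaOp δ ψ g

/-- The elements of `Θ C` with leader lower than `v`. -/
def thetaBelow [LinearOrder (DVar m n)] (C : Set (MvPolynomial (DVar m n) k)) (v : DVar m n) :
    Set (MvPolynomial (DVar m n) k) :=
  {p ∈ thetaSet δ C | ∃ w, IsLeader p w ∧ w < v}

theorem exists_eq_sup_tsub_add {ι : Type*} {a b θ ψ : ι →₀ ℕ} (h : θ + a = ψ + b) :
    ∃ φ, θ = a ⊔ b - a + φ ∧ ψ = a ⊔ b - b + φ := by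
  refine ⟨θ + a - a ⊔ b, Finsupp.ext fun i => ?_, Finsupp.ext fun i => ?_⟩ <;>
  · have hi := DFunLike.congr_fun h i
    simp only [Finsupp.add_apply, Finsupp.tsub_apply, Finsupp.sup_apply] at hi ⊢
    omega

theorem DVar.act_tsub_add {u w : DVar m n} (hop : u.op ≤ w.op) (hvar : u.var = w.var)
    (φ : Fin m →₀ ℕ) : u.act (w.op - u.op + φ) = w.act φ := by
  refine DVar.ext ?_ hvar
  change w.op - u.op + φ + u.op = φ + w.op
  rw [add_right_comm, tsub_add_cancel_of_le hop, add_comm]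

variable [LinearOrder (DVar m n)] (hδ : ∀ i j a, δ i (δ j a) = δ j (δ i a)) (hr : IsRanking m n)

include hr in
theorem thetaBelow_subset (C : Set (MvPolynomial (DVar m n) k)) (w : DVar m n) (i : Fin m) :
    thetaBelow δ C w ⊆ thetaBelow δ C (w.act (Finsupp.single i 1)) :=
  fun _ ⟨hp, x, hx, hxw⟩ => ⟨hp, x, hx, hxw.trans_le (hr.1 _ _)⟩

theorem exists_isTriangularSection (C : Set (MvPolynomial (DVar m n) k)) :
    ∃ B, IsTriangularSection δ C B := by
  have h (u : leaders (thetaSet δ C)) : ∃ f ∈ thetaSet δ C, IsLeader f u := u.2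
  choose b hb hbu using h
  refine ⟨Set.range b, Set.range_subset_iff.2 hb, ⟨?_, ?_⟩, Set.Subset.antisymm ?_ ?_⟩
  · rintro _ ⟨u, rfl⟩
    exact (hbu u).nonempty
  · rintro _ ⟨u, rfl⟩ _ ⟨v, rfl⟩ w hu hv
    exact congr_arg b (Subtype.ext (((hbu u).unique hu).trans (hv.unique (hbu v))))
  · exact leaders_mono (Set.range_subset_iff.2 hb)
  · exact fun u hu => ⟨_, ⟨⟨u, hu⟩, rfl⟩, hbu ⟨u, hu⟩⟩

variable [CharZero k] {C B : Set (MvPolynomial (DVar m n) k)}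

include hδ hr

theorem dpDeriv_mem_span_thetaBelow {w : DVar m n} {p : MvPolynomial (DVar m n) k}
    (hp : p ∈ Ideal.span (thetaBelow δ C w)) (i : Fin m) :
    dpDeriv δ i p ∈ Ideal.span (thetaBelow δ C (w.act (Finsupp.single i 1))) := by
  refine dpDeriv_mem_span δ i (thetaBelow_subset δ hr C w i) ?_ hp
  rintro q ⟨hq, x, hx, hxw⟩
  refine Ideal.subset_span ⟨dpDeriv_mem_thetaSet δ hδ hq i, _, ?_, hr.act_lt_act _ hxw⟩
  have := hx.thetaOp δ hδ hr (Finsupp.single i 1)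
  rwa [← zero_add (Finsupp.single i 1), thetaOp_add_single δ hδ, thetaOp_zero, zero_add] at this

section DeltaPoly

variable {f g : MvPolynomial (DVar m n) k} {u v : DVar m n} (hf : f ∈ C) (hg : g ∈ C)
  (hu : IsLeader f u) (hv : IsLeader g v)

include hf hg hu hv

theorem deltaPoly_add_single_mem {θ ψ : Fin m →₀ ℕ} (i : Fin m) (hθψ : u.act θ = v.act ψ)
    (h : deltaPoly δ f g θ ψ ∈ saturation (Ideal.span (thetaBelow δ C (u.act θ))) (HSet C)) :
    deltaPoly δ f g (θ + Finsupp.single i 1) (ψ + Finsupp.single i 1) ∈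
      saturation (Ideal.span (thetaBelow δ C ((u.act θ).act (Finsupp.single i 1)))) (HSet C) := by
  set w := u.act θ with hw
  have hlt : w < w.act (Finsupp.single i 1) := hr.lt_act (by simp) _
  have hmem {p : MvPolynomial (DVar m n) k} {x : DVar m n} {η : Fin m →₀ ℕ} (hp : p ∈ C)
      (hx : IsLeader p x) (hxw : x.act η = w) : thetaOp δ η p ∈
        saturation (Ideal.span (thetaBelow δ C (w.act (Finsupp.single i 1)))) (HSet C) :=
    le_saturation _ _ (Ideal.subset_span
      ⟨⟨p, hp, η, rfl⟩, x.act η, hx.thetaOp δ hδ hr η, hxw.trans_lt hlt⟩)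
  have hderiv := dpDeriv_mem_saturation δ i (Ideal.span_mono (thetaBelow_subset δ hr C w i))
    (fun p hp => dpDeriv_mem_span_thetaBelow δ hδ hr hp i) h
  rw [deltaPoly, map_sub, dpDeriv_mul, dpDeriv_mul, ← thetaOp_add_single δ hδ,
    ← thetaOp_add_single δ hδ] at hderiv
  convert Ideal.add_mem _ (Ideal.sub_mem _ hderiv
    (Ideal.mul_mem_right (dpDeriv δ i (separant g)) _ (hmem hf hu hw.symm)))
    (Ideal.mul_mem_right (dpDeriv δ i (separant f)) _ (hmem hg hv hθψ.symm)) using 1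
  rw [deltaPoly]
  ring

theorem Coherent.deltaPoly_mem (hC : Coherent δ C) {θ ψ : Fin m →₀ ℕ}
    (hθψ : u.act θ = v.act ψ) : deltaPoly δ f g θ ψ ∈
      saturation (Ideal.span (thetaBelow δ C (u.act θ))) (HSet C) := by
  have hvar : u.var = v.var := (congr_arg DVar.var hθψ :)
  obtain ⟨φ, rfl, rfl⟩ := exists_eq_sup_tsub_add (congr_arg DVar.op hθψ)
  clear hθψ
  let w : DVar m n := ⟨u.op ⊔ v.op, u.var⟩
  have hactu : ∀ φ, u.act (w.op - u.op + φ) = w.act φ := DVar.act_tsub_add le_sup_left rfl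
  have hactv : ∀ φ, v.act (w.op - v.op + φ) = w.act φ :=
    DVar.act_tsub_add le_sup_right hvar.symm
  induction φ using finsuppNat_induction with
  | zero =>
    rw [hactu, add_zero, add_zero, DVar.act_zero]
    exact hC f hf g hg u v hu hv hvar
  | add_single φ i ih =>
    have hstep := deltaPoly_add_single_mem δ hδ hr hf hg hu hv i
      ((hactu φ).trans (hactv φ).symm) ih
    rwa [DVar.act_act, add_comm _ (_ + φ), add_assoc, add_assoc] at hstep

end DeltaPoly

variable (hne : ∀ f ∈ C, f.vars.Nonempty) (hB : IsTriangularSection δ C B)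

include hne

include hB in
theorem IsTriangularSection.HSet_subset : HSet B ⊆ HSet C :=
  (Set.union_subset_union (Set.image_mono hB.1) (Set.image_mono hB.1)).trans
    (HSet_thetaSet_subset δ hδ hr hne)

include hB in
theorem IsTriangularSection.leaders_eq : leaders B = thetaVars (leaders C) :=
  hB.2.2.trans (leaders_thetaSet δ hδ hr hne)

include hB in
theorem Coherent.satDiffIdeal_le (hC : Coherent δ C) :
    satDiffIdeal δ C ≤ saturation (Ideal.span B) (HSet C) := by
  have hwf := hr.wellFoundedLT
  have hreg := subset_regularMod_saturation (Ideal.span B) (HSet C)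
  have hmem (v : DVar m n) : ∀ p ∈ thetaSet δ C, IsLeader p v →
      p ∈ saturation (Ideal.span B) (HSet C) := by
    induction v using WellFoundedLT.induction with
    | ind v ih =>
      rintro p hp hpv
      obtain ⟨b, hb, hbv⟩ : v ∈ leaders B := hB.2.2.ge ⟨p, hp, hpv⟩
      obtain ⟨f, hf, θ, rfl⟩ := hp
      obtain ⟨g, hg, ψ, rfl⟩ := hB.1 hb
      obtain ⟨u, hu⟩ := exists_isLeader (hne f hf)
      obtain ⟨w, hw⟩ := exists_isLeader (hne g hg)
      obtain rfl := hpv.unique (hu.thetaOp δ hδ hr θ)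
      have hbelow : thetaBelow δ C (u.act θ) ⊆ saturation (Ideal.span B) (HSet C) :=
        fun q ⟨hq, x, hx, hxv⟩ => ih x hxv q hq hx
      have hdelta := saturation_le (Ideal.span_le.2 hbelow) hreg
        (hC.deltaPoly_mem δ hδ hr hf hg hu hw (hbv.unique (hw.thetaOp δ hδ hr ψ)))
      refine (mem_regularMod_iff.1 (hreg (Or.inr ⟨g, hg, rfl⟩))) _ ?_
      have hsum := Ideal.add_mem _ hdelta (Ideal.mul_mem_left _ (separant f)
        (le_saturation _ (HSet C) (Ideal.subset_span hb)))
      rwa [deltaPoly, sub_add_cancel] at hsum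
  refine saturation_le (Ideal.span_le.2 fun p hp => ?_) hreg
  obtain ⟨f, hf, θ, rfl⟩ := id hp
  obtain ⟨u, hu⟩ := exists_isLeader (hne f hf)
  exact hmem _ _ hp (hu.thetaOp δ hδ hr θ)

theorem Coherent.initial_mem (hC : Coherent δ C) {f : MvPolynomial (DVar m n) k} {u : DVar m n}
    (hf : f ∈ satDiffIdeal δ C) (hu : IsLeader f u) (huC : u ∉ thetaVars (leaders C)) :
    initial f ∈ satDiffIdeal δ C := by
  have hwf := hr.wellFoundedLT
  obtain ⟨B, hB⟩ := exists_isTriangularSection δ C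
  have hsep : ∀ b ∈ B, separant b ∈ HSet C := fun b hb =>
    hB.HSet_subset δ hδ hr hne (Or.inr ⟨b, hb, rfl⟩)
  rw [← hB.leaders_eq δ hδ hr hne] at huC
  have hle : saturation (Ideal.span B) (HSet C) ≤ satDiffIdeal δ C :=
    saturation_le (Ideal.span_le.2 (hB.1.trans (thetaSet_subset_satDiffIdeal δ C)))
      (subset_regularMod_saturation _ _)
  exact hle (hB.2.1.initial_mem_saturation hsep huC (hC.satDiffIdeal_le δ hδ hr hne hB hf) hu)

end Coherence

section ReducedVars

/-! ### Autoreduced sets -/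

variable {m n : ℕ} {L L' : Set (DVar m n)}

/-- No element of `L` is a proper derivative of an element of `L`. Such sets are the sets of
leaders of the autoreduced sets. -/
def IsThetaAntichain (L : Set (DVar m n)) : Prop :=
  ∀ u ∈ L, ∀ θ : Fin m →₀ ℕ, θ ≠ 0 → u.act θ ∉ L

/-- The derivatives that are in `L` or are not derivatives of elements of `L`. If `L` is the set
of leaders of an autoreduced set `C`, these are the variables of the polynomials that are partially
reduced with respect to `C`. -/
def reducedVars (L : Set (DVar m n)) : Set (DVar m n) := (thetaVars L \ L)ᶜ

theorem subset_thetaVars (L : Set (DVar m n)) : L ⊆ thetaVars L := fun u hu =>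
  ⟨u, hu, 0, (DVar.act_zero u).symm⟩

theorem subset_reducedVars (L : Set (DVar m n)) : L ⊆ reducedVars L := fun _ hu hu' => hu'.2 hu

theorem reducedVars_subset_prolongationVars (h : L ⊆ L') :
    reducedVars L ⊆ prolongationVars L L' := by
  intro v hv
  by_cases hvL : v ∈ thetaVars L
  · exact Or.inl (h (by_contra fun h' => hv ⟨hvL, h'⟩))
  · exact Or.inr hvL

theorem IsThetaAntichain.act_notMem_reducedVars (hL : IsThetaAntichain L) {u : DVar m n}
    (hu : u ∈ L) {θ : Fin m →₀ ℕ} (hθ : θ ≠ 0) : u.act θ ∉ reducedVars L :=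
  fun h => h ⟨⟨u, hu, θ, rfl⟩, hL u hu θ hθ⟩

theorem IsThetaAntichain.subset_of_subset_thetaVars (hL : IsThetaAntichain L)
    (h : L ⊆ thetaVars L') (h' : L' ⊆ thetaVars L) : L ⊆ L' := by
  intro u hu
  obtain ⟨w, hw, θ, rfl⟩ := h hu
  obtain ⟨u', hu', ψ, rfl⟩ := h' hw
  rw [DVar.act_act] at hu
  have h0 : θ + ψ = 0 := by_contra fun h => hL u' hu' _ h hu
  obtain ⟨rfl, -⟩ := add_eq_zero.1 h0
  rwa [DVar.act_zero]

variable {k : Type*} [Field k] [LinearOrder (DVar m n)] {A : Set (MvPolynomial (DVar m n) k)}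

theorem partiallyReduced_of_mem_supported (hL : IsThetaAntichain L)
    {f g : MvPolynomial (DVar m n) k} (hf : f ∈ supported k (reducedVars L)) {u : DVar m n}
    (hu : IsLeader g u) (huL : u ∈ L) : PartiallyReduced f g := by
  intro v hv θ hθ hmem
  obtain rfl := hv.unique hu
  exact hL.act_notMem_reducedVars huL hθ (MvPolynomial.mem_supported.1 hf hmem)

theorem AlgAutoreduced.autoreduced (hA : AlgAutoreduced A) (hanti : IsThetaAntichain (leaders A))
    (hsup : A ⊆ supported k (reducedVars (leaders A))) : Autoreduced A := by
  refine ⟨hA.1, fun f hf g hg hne => ⟨?_, hA.2 f hf g hg hne⟩⟩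
  obtain ⟨u, hu⟩ := exists_isLeader (hA.1 g hg)
  exact partiallyReduced_of_mem_supported hanti (hsup hf) hu ⟨g, hg, hu⟩

theorem Autoreduced.algAutoreduced (hA : Autoreduced A) : AlgAutoreduced A :=
  ⟨hA.1, fun f hf g hg hne => (hA.2 f hf g hg hne).2⟩

variable (hr : IsRanking m n)

include hr

theorem Autoreduced.partiallyReduced (hA : Autoreduced A) {f g : MvPolynomial (DVar m n) k}
    (hf : f ∈ A) (hg : g ∈ A) : PartiallyReduced f g := by
  rcases eq_or_ne f g with rfl | hne
  · exact fun u hu θ hθ => hu.notMem_vars_of_lt (hr.lt_act hθ u)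
  · exact (hA.2 f hf g hg hne).1

theorem Autoreduced.isThetaAntichain (hA : Autoreduced A) : IsThetaAntichain (leaders A) := by
  rintro u ⟨f, hf, hu⟩ θ hθ ⟨g, hg, hgu⟩
  exact hA.partiallyReduced hr hg hf u hu θ hθ hgu.1

theorem Autoreduced.subset_supported (hA : Autoreduced A) :
    A ⊆ supported k (reducedVars (leaders A)) := by
  refine fun f hf => MvPolynomial.mem_supported.2 ?_
  rintro v hv ⟨⟨u, ⟨g, hg, hu⟩, θ, rfl⟩, hvA⟩
  refine hA.partiallyReduced hr hf hg u hu θ ?_ hv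
  rintro rfl
  rw [DVar.act_zero] at hvA
  exact hvA ⟨g, hg, hu⟩

theorem Autoreduced.insertAt (hA : Autoreduced A) {p : MvPolynomial (DVar m n) k} {u : DVar m n}
    (hu : IsLeader p u) (hps : p ∈ supported k (reducedVars (leaders A)))
    (hp : ∀ a ∈ A, AlgReduced p a) : Autoreduced (insertAt A u p) := by
  have hins := hA.algAutoreduced.insertAt hu hp
  refine ⟨hins.1, fun f hf g hg hne => ⟨?_, hins.2 f hf g hg hne⟩⟩
  rcases hf with rfl | ⟨hf, w, hw, hlt⟩ <;> rcases hg with rfl | hg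
  · exact absurd rfl hne
  · obtain ⟨hg, w, hw, -⟩ := hg
    exact partiallyReduced_of_mem_supported (hA.isThetaAntichain hr) hps hw ⟨g, hg, hw⟩
  · intro v hv θ hθ
    obtain rfl := hv.unique hu
    exact hw.notMem_vars_of_lt (hlt.trans (hr.lt_act hθ v))
  · exact hA.partiallyReduced hr hf hg.1

theorem isDiffCharSet_iff {I : Ideal (MvPolynomial (DVar m n) k)} (h1 : 1 ∉ I) :
    IsDiffCharSet I A ↔ Autoreduced A ∧ IsCharSetOn I (reducedVars (leaders A)) A := by
  refine and_congr_right fun hA => ⟨fun ⟨hAI, hmin⟩ => ?_, fun h => ⟨h.subset, ?_⟩⟩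
  · refine ⟨hA.algAutoreduced, hAI, hA.subset_supported hr, fun p hp hps hred => ?_⟩
    by_contra hp0
    obtain ⟨u, hu⟩ := exists_isLeader (vars_nonempty_of_mem h1 hp hp0)
    exact hmin _ (hA.insertAt hr hu hps hred)
      ((insertAt_subset_insert A u p).trans (Set.insert_subset hp hAI)) (lowerRank_insertAt hu hred)
  · intro B hB hBI hlow
    obtain ⟨p, hp, u, hu, hred, hlower⟩ := hlow.exists_algReduced hB.algAutoreduced
    refine hu.ne_zero (h.eq_zero_of_reduced p (hBI hp) ?_ hred)
    refine MvPolynomial.mem_supported.2 ?_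
    rintro _ hv ⟨⟨w, hw, θ, rfl⟩, hvA⟩
    have hθ : θ ≠ 0 := by
      rintro rfl
      rw [DVar.act_zero] at hvA
      exact hvA hw
    have hwB := hlower w hw ((hr.lt_act hθ w).trans_le (hu.2 _ hv))
    exact (hB.isThetaAntichain hr).act_notMem_reducedVars hwB hθ
      (MvPolynomial.mem_supported.1 (hB.subset_supported hr hp) hv)

end ReducedVars

section Reduction

/-! ### Reduction with respect to a triangular section -/

variable {σ : Type*} [LinearOrder σ] {k : Type*} [Field k]

theorem AlgReduced.notMem_vars {f b : MvPolynomial σ k} (h : AlgReduced f b) {v : σ}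
    (hv : IsLeader b v) (hd : b.degreeOf v ≤ 1) : v ∉ f.vars := by
  rw [mem_vars_iff_degreeOf_ne_zero, not_not]
  exact Nat.lt_one_iff.1 ((h v hv).trans_le hd)

theorem algReduced_of_notMem_vars {f b : MvPolynomial σ k} {v : σ} (hv : IsLeader b v)
    (h : v ∉ f.vars) : AlgReduced f b := by
  intro w hw
  obtain rfl := hw.unique hv
  rw [degreeOf_eq_zero_of_notMem h]
  exact hw.degreeOf_pos

variable {m n : ℕ} (δ : Fin m → Derivation ℤ k k) [LinearOrder (DVar m n)]
  (hδ : ∀ i j a, δ i (δ j a) = δ j (δ i a)) (hr : IsRanking m n) [CharZero k]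
  {C B : Set (MvPolynomial (DVar m n) k)} (hC : Autoreduced C)

section TriangularSection

variable (hB : IsTriangularSection δ C B)

omit [CharZero k] in
include hB in
theorem IsTriangularSection.subset_satDiffIdeal : B ⊆ satDiffIdeal δ C :=
  hB.1.trans (thetaSet_subset_satDiffIdeal δ C)

include hδ hr hC hB

theorem IsTriangularSection.HSet_subset_regularMod :
    HSet B ⊆ regularMod (satDiffIdeal δ C) :=
  (hB.HSet_subset δ hδ hr hC.1).trans (subset_regularMod_saturation _ _)

theorem IsTriangularSection.initial_subset_regularMod :
    initial '' B ⊆ regularMod (satDiffIdeal δ C) :=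
  Set.subset_union_left.trans (hB.HSet_subset_regularMod δ hδ hr hC)

theorem IsTriangularSection.mem_of_isLeader {b : MvPolynomial (DVar m n) k} (hb : b ∈ B)
    {v : DVar m n} (hv : IsLeader b v) (hvC : v ∈ leaders C) : b ∈ C := by
  obtain ⟨c, hc, θ, rfl⟩ := hB.1 hb
  obtain ⟨u, hu⟩ := exists_isLeader (hC.1 c hc)
  obtain rfl := hv.unique (hu.thetaOp δ hδ hr θ)
  obtain rfl : θ = 0 := by_contra fun hθ => hC.isThetaAntichain hr u ⟨c, hc, hu⟩ θ hθ hvC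
  rwa [thetaOp_zero]

theorem IsTriangularSection.degreeOf_eq_one {b : MvPolynomial (DVar m n) k} (hb : b ∈ B)
    {v : DVar m n} (hv : IsLeader b v) (hvC : v ∉ leaders C) : b.degreeOf v = 1 := by
  obtain ⟨c, hc, θ, rfl⟩ := hB.1 hb
  obtain ⟨u, hu⟩ := exists_isLeader (hC.1 c hc)
  obtain rfl := hv.unique (hu.thetaOp δ hδ hr θ)
  refine degreeOf_thetaOp δ hδ hr hu ?_
  rintro rfl
  rw [DVar.act_zero] at hvC
  exact hvC ⟨c, hc, hu⟩

theorem IsTriangularSection.subset : C ⊆ B := by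
  intro c hc
  obtain ⟨u, hu⟩ := exists_isLeader (hC.1 c hc)
  obtain ⟨b, hb, hbu⟩ : u ∈ leaders B := by
    rw [hB.leaders_eq δ hδ hr hC.1]
    exact subset_thetaVars _ ⟨c, hc, hu⟩
  have hbC := hB.mem_of_isLeader δ hδ hr hC hb hbu ⟨c, hc, hu⟩
  rwa [hC.algAutoreduced.triangular.2 c hc b hbC u hu hbu]

theorem IsTriangularSection.mem_supported_of_algReduced {p : MvPolynomial (DVar m n) k}
    (hp : ∀ b ∈ B, AlgReduced p b) : p ∈ supported k (reducedVars (leaders C)) := by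
  refine MvPolynomial.mem_supported.2 fun v hv ⟨hvθ, hvC⟩ => ?_
  rw [← hB.leaders_eq δ hδ hr hC.1] at hvθ
  obtain ⟨b, hb, hbv⟩ := hvθ
  exact (hp b hb).notMem_vars hbv (hB.degreeOf_eq_one δ hδ hr hC hb hbv hvC).le hv

theorem IsTriangularSection.algReduced {c b : MvPolynomial (DVar m n) k} (hc : c ∈ C)
    (hb : b ∈ B) (hne : c ≠ b) : AlgReduced c b := by
  obtain ⟨w, hw⟩ := exists_isLeader (hB.2.1.1 b hb)
  by_cases hwC : w ∈ leaders C
  · exact (hC.2 c hc b (hB.mem_of_isLeader δ hδ hr hC hb hw hwC) hne).2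
  · refine algReduced_of_notMem_vars hw fun hwc => ?_
    have hwB : w ∈ thetaVars (leaders C) := hB.leaders_eq δ hδ hr hC.1 ▸ ⟨b, hb, hw⟩
    exact MvPolynomial.mem_supported.1 (hC.subset_supported hr hc) hwc ⟨hwB, hwC⟩

theorem IsTriangularSection.eq_zero_of_reduced
    (hcs : IsCharSetOn (satDiffIdeal δ C) (reducedVars (leaders C)) C)
    {p : MvPolynomial (DVar m n) k} (hp : p ∈ satDiffIdeal δ C) (hred : ∀ b ∈ B, AlgReduced p b) :
    p = 0 :=
  hcs.eq_zero_of_reduced p hp (hB.mem_supported_of_algReduced δ hδ hr hC hred)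
    fun c hc => hred c (hB.subset δ hδ hr hC hc)

end TriangularSection

section Remainder

variable (hB : IsTriangularSection δ C B) {f g : MvPolynomial (DVar m n) k} (hf : f ∈ B)
  (hg : IsAlgRem (B \ {f}) f g) {v : DVar m n} (hv : IsLeader f v)

omit [CharZero k] in
include hB hf hg in
theorem IsTriangularSection.algRem_mem : g ∈ satDiffIdeal δ C := by
  have hBI := hB.subset_satDiffIdeal δ
  exact hg.pseudoReduces.mem_of_mem (Set.sdiff_subset.trans hBI) (hBI hf)

include hδ hr hC hB hf hg hv

theorem IsTriangularSection.hasRegularRank_algRem (h1 : 1 ∉ satDiffIdeal δ C) :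
    HasRegularRank (satDiffIdeal δ C) v (f.degreeOf v) g := by
  have hreg := hB.initial_subset_regularMod δ hδ hr hC
  refine hg.pseudoReduces.hasRegularRank h1 (Set.sdiff_subset.trans (hB.subset_satDiffIdeal δ))
    ((Set.image_mono Set.sdiff_subset).trans hreg) ?_ ⟨hv, rfl, hreg ⟨f, hf, rfl⟩⟩
  exact fun b hb hbv => absurd (hB.2.1.2 b hb.1 f hf v hbv hv) hb.2

theorem IsTriangularSection.algRem_mem_supported :
    g ∈ supported k (insert v (reducedVars (leaders C))) := by
  refine MvPolynomial.mem_supported.2 fun w hw => ?_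
  by_contra hwn
  obtain ⟨hwv, hwN⟩ := not_or.1 hwn
  obtain ⟨hwθ, hwC⟩ : w ∈ thetaVars (leaders C) \ leaders C := not_not.1 hwN
  rw [← hB.leaders_eq δ hδ hr hC.1] at hwθ
  obtain ⟨b, hb, hbw⟩ := hwθ
  have hbf : b ≠ f := by
    rintro rfl
    exact hwv (hbw.unique hv)
  exact (hg.2 b ⟨hb, hbf⟩).notMem_vars hbw (hB.degreeOf_eq_one δ hδ hr hC hb hbw hwC).le hw

theorem IsTriangularSection.separant_algRem_mem (h1 : 1 ∉ satDiffIdeal δ C) :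
    separant g ∈ regularMod (satDiffIdeal δ C) := by
  by_cases hvC : v ∈ leaders C
  · have hfC := hB.mem_of_isLeader δ hδ hr hC hf hv hvC
    have hgf : g = f := hg.eq_self fun b hb =>
      hB.algReduced δ hδ hr hC hfC hb.1 (Ne.symm hb.2)
    rw [hgf]
    exact hB.HSet_subset_regularMod δ hδ hr hC (Or.inr ⟨f, hf, rfl⟩)
  · obtain ⟨hgv, hd, hi⟩ := hB.hasRegularRank_algRem δ hδ hr hC hf hg hv h1
    rw [hB.degreeOf_eq_one δ hδ hr hC hf hv hvC] at hd
    rwa [hgv.separant_eq, pderiv_of_degreeOf_eq_one hd, ← hd, ← hgv.initial_eq]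

end Remainder

include hδ hr hC

theorem Autoreduced.exists_mul_sub_mem (p : MvPolynomial (DVar m n) k) :
    ∃ s ∈ Submonoid.closure (HSet C), ∃ g ∈ supported k (reducedVars (leaders C)),
      (∀ c ∈ C, AlgReduced g c) ∧ s * p - g ∈ diffSpan δ C := by
  have hwf := hr.wellFoundedLT
  obtain ⟨B, hB⟩ := exists_isTriangularSection δ C
  obtain ⟨g, hg⟩ := hB.2.1.exists_isAlgRem p
  obtain ⟨s, hs, hsp⟩ := hg.pseudoReduces.exists_mul_sub_mem
  exact ⟨s, Submonoid.closure_mono (hB.HSet_subset δ hδ hr hC.1) hs, g,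
    hB.mem_supported_of_algReduced δ hδ hr hC hg.2,
    fun c hc => hg.2 c (hB.subset δ hδ hr hC hc), Ideal.span_mono hB.1 hsp⟩

theorem Autoreduced.exists_mul_sub_rename_mem {Z : Set (DVar m n)}
    (hZ : reducedVars (leaders C) ⊆ Z) (p : MvPolynomial (DVar m n) k) :
    ∃ s ∈ regularMod (satDiffIdeal δ C), ∃ g : MvPolynomial Z k,
      s * p - rename Subtype.val g ∈ satDiffIdeal δ C := by
  obtain ⟨s, hs, g, hg, -, hsp⟩ := hC.exists_mul_sub_mem δ hδ hr p
  obtain ⟨g, rfl⟩ := exists_rename_val_eq (supported_mono hZ hg)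
  exact ⟨s, Submonoid.closure_le.2 (subset_regularMod_saturation _ _) hs, g,
    le_saturation _ _ hsp⟩

theorem Autoreduced.isPrime_iff_restrictIdeal {Z : Set (DVar m n)}
    (hZ : reducedVars (leaders C) ⊆ Z) :
    (satDiffIdeal δ C).IsPrime ↔ (restrictIdeal (satDiffIdeal δ C) Z).IsPrime :=
  isPrime_iff_comap (hC.exists_mul_sub_rename_mem δ hδ hr hZ)

theorem Autoreduced.isAlgCharacterizing_restrictIdeal_iff (h1 : 1 ∉ satDiffIdeal δ C)
    {Z : Set (DVar m n)} (hZ : reducedVars (leaders C) ⊆ Z) {A : Set (MvPolynomial Z k)} :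
    IsAlgCharacterizing (restrictIdeal (satDiffIdeal δ C) Z) A ↔
      IsCharacterizingOn (satDiffIdeal δ C) Z (liftSet A) := by
  have hwf := hr.wellFoundedLT
  have h1Z : 1 ∉ restrictIdeal (satDiffIdeal δ C) Z := by
    rwa [restrictIdeal, Ideal.mem_comap, map_one]
  have hreg (h : MvPolynomial Z k) : rename Subtype.val h ∈ regularMod (satDiffIdeal δ C) ↔
      h ∈ regularMod (restrictIdeal (satDiffIdeal δ C) Z) :=
    map_mem_regularMod_iff (hC.exists_mul_sub_rename_mem δ hδ hr hZ)
  have hHSet : HSet (liftSet A) ⊆ regularMod (satDiffIdeal δ C) ↔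
      HSet A ⊆ regularMod (restrictIdeal (satDiffIdeal δ C) Z) := by
    rw [liftSet, HSet_image_rename (Subtype.strictMono_coe Z), Set.image_subset_iff]
    exact forall₂_congr fun h _ => hreg h
  rw [isAlgCharacterizing_iff h1Z, isAlgCharSet_restrictIdeal_iff h1, ← hHSet]
  exact ⟨fun h => ⟨h.1, h.2⟩, fun h => ⟨h.toIsCharSetOn, h.HSet_subset⟩⟩

omit hC in
theorem IsDiffCharSet.isDiffCharacterizing {I : Ideal (MvPolynomial (DVar m n) k)} (h1 : 1 ∉ I)
    {A : Set (MvPolynomial (DVar m n) k)} (hA : IsDiffCharSet I A) (hle : diffSpan δ A ≤ I)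
    (hreg : HSet A ⊆ regularMod I) : IsDiffCharacterizing δ I A := by
  obtain ⟨hauto, hcs⟩ := (isDiffCharSet_iff hr h1).1 hA
  refine ⟨hA, le_antisymm (fun p hp => ?_) (saturation_le hle hreg)⟩
  obtain ⟨s, hs, g, hg, hred, hsg⟩ := hauto.exists_mul_sub_mem δ hδ hr p
  have hgI : g ∈ I := (I.sub_mem_iff_right (I.mul_mem_left s hp)).1 (hle hsg)
  rw [hcs.eq_zero_of_reduced g hgI hg hred, sub_zero] at hsg
  exact ⟨s, hs, hsg⟩

end Reduction

section WithLeaders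

/-! ### Elements with prescribed leaders -/

variable {σ : Type*} [LinearOrder σ] {k : Type*} [Field k]

/-- The elements of `A` whose leader is in `L`: this is how a characteristic set of a differential
ideal is selected from one of a prolongation ideal. -/
def withLeaders (A : Set (MvPolynomial σ k)) (L : Set σ) : Set (MvPolynomial σ k) :=
  {a ∈ A | ∃ u ∈ L, IsLeader a u}

theorem withLeaders_subset (A : Set (MvPolynomial σ k)) (L : Set σ) : withLeaders A L ⊆ A :=
  Set.sep_subset _ _

theorem leaders_withLeaders {A : Set (MvPolynomial σ k)} {L : Set σ} (hL : L ⊆ leaders A) :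
    leaders (withLeaders A L) = L := by
  refine Set.Subset.antisymm ?_ fun u hu => ?_
  · rintro u ⟨a, ⟨-, v, hv, hav⟩, hau⟩
    rwa [hau.unique hav]
  · obtain ⟨a, ha, hau⟩ := hL hu
    exact ⟨a, ⟨ha, u, hu, hau⟩, hau⟩

theorem AlgAutoreduced.mono {A B : Set (MvPolynomial σ k)} (hB : AlgAutoreduced B) (h : A ⊆ B) :
    AlgAutoreduced A :=
  ⟨fun f hf => hB.1 f (h hf), fun f hf g hg => hB.2 f (h hf) g (h hg)⟩

theorem AlgAutoreduced.algReduced_initial {A : Set (MvPolynomial σ k)} (hA : AlgAutoreduced A)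
    {a b : MvPolynomial σ k} (ha : a ∈ A) (hb : b ∈ A) : AlgReduced (initial a) b := by
  intro v hv
  rcases eq_or_ne a b with rfl | hab
  · exact algReduced_of_notMem_vars hv hv.notMem_vars_initial v hv
  · obtain ⟨u, hu⟩ := exists_isLeader (hA.1 a ha)
    rw [hu.initial_eq]
    exact (degreeOf_coeffAt_le _ _ _ _).trans_lt (hA.2 a ha b hb hab v hv)

theorem HSet_mono {A B : Set (MvPolynomial σ k)} (h : A ⊆ B) : HSet A ⊆ HSet B :=
  Set.union_subset_union (Set.image_mono h) (Set.image_mono h)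

variable {m n : ℕ} [LinearOrder (DVar m n)]

theorem withLeaders_prolongationVars {B : Set (MvPolynomial (DVar m n) k)} {L : Set (DVar m n)}
    (hB : leaders B ⊆ thetaVars L) (L' : Set (DVar m n)) :
    withLeaders B (prolongationVars L L') = withLeaders B L' := by
  refine Set.Subset.antisymm ?_ ?_
  · rintro b ⟨hb, u, hu | hu, hbu⟩
    · exact ⟨hb, u, hu, hbu⟩
    · exact absurd (hB ⟨b, hb, hbu⟩) hu
  · rintro b ⟨hb, u, hu, hbu⟩
    exact ⟨hb, u, Or.inl hu, hbu⟩

end WithLeaders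

section Prolongation

/-! ### Characterizing sets of prolongation ideals -/

variable {k : Type*} [Field k] {m n : ℕ} (δ : Fin m → Derivation ℤ k k) [LinearOrder (DVar m n)]
  [CharZero k] (hδ : ∀ i j a, δ i (δ j a) = δ j (δ i a)) (hr : IsRanking m n)
  {A B C : Set (MvPolynomial (DVar m n) k)} {Z : Set (DVar m n)}

include hδ hr

theorem Coherent.leaders_subset (hC : Coherent δ C) (hne : ∀ f ∈ C, f.vars.Nonempty)
    (hA : IsCharSetOn (satDiffIdeal δ C) Z A) : leaders A ⊆ thetaVars (leaders C) := by
  rintro u ⟨a, ha, hu⟩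
  by_contra huC
  refine hu.initial_ne_zero (hA.eq_zero_of_reduced _
    (hC.initial_mem δ hδ hr hne (hA.subset ha) hu huC) ?_
    fun b hb => hA.algAutoreduced.algReduced_initial ha hb)
  exact supported_mono (fun _ hv => MvPolynomial.mem_supported.1 (hA.supported ha) hv.1)
    hu.initial_mem_supported

theorem IsDiffCharSet.leaders_subset (hC : IsDiffCharSet (satDiffIdeal δ C) C)
    (h1 : 1 ∉ satDiffIdeal δ C) (hA : A ⊆ satDiffIdeal δ C)
    (hreg : initial '' A ⊆ regularMod (satDiffIdeal δ C)) : leaders A ⊆ thetaVars (leaders C) := by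
  have hwf := hr.wellFoundedLT
  obtain ⟨hauto, hcs⟩ := (isDiffCharSet_iff hr h1).1 hC
  obtain ⟨B, hB⟩ := exists_isTriangularSection δ C
  have hBI := hB.subset_satDiffIdeal δ
  rintro v ⟨a, ha, hv⟩
  obtain ⟨g, hg⟩ := hB.2.1.exists_isAlgRem a
  obtain rfl : g = 0 :=
    hB.eq_zero_of_reduced δ hδ hr hauto hcs (hg.pseudoReduces.mem_of_mem hBI (hA ha)) hg.2
  obtain ⟨b, hb, hbv, -⟩ := hg.pseudoReduces.exists_isLeader_of_zero h1 hBI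
    (hB.initial_subset_regularMod δ hδ hr hauto) hv (hreg ⟨a, ha, rfl⟩)
  rw [← hB.leaders_eq δ hδ hr hauto.1]
  exact ⟨b, hb, hbv⟩

theorem IsTriangularSection.isCharacterizingOn (hB : IsTriangularSection δ C B)
    (hC : IsDiffCharSet (satDiffIdeal δ C) C) (h1 : 1 ∉ satDiffIdeal δ C)
    (hZ : reducedVars (leaders C) ⊆ Z)
    {algrem : MvPolynomial (DVar m n) k → MvPolynomial (DVar m n) k}
    (hrem : ∀ f ∈ B, IsAlgRem (B \ {f}) f (algrem f)) :
    IsCharacterizingOn (satDiffIdeal δ C) Z (algrem '' withLeaders B Z) := by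
  obtain ⟨hauto, hcs⟩ := (isDiffCharSet_iff hr h1).1 hC
  have hrank {f} (hf : f ∈ B) {v} (hv : IsLeader f v) :=
    hB.hasRegularRank_algRem δ hδ hr hauto hf (hrem f hf) hv h1
  refine ⟨⟨⟨?_, ?_⟩, ?_, ?_, fun p hp hpZ hred => ?_⟩, Set.union_subset ?_ ?_⟩
  · rintro _ ⟨f, ⟨hf, v, -, hv⟩, rfl⟩
    exact (hrank hf hv).1.nonempty
  · rintro _ ⟨f, ⟨hf, -⟩, rfl⟩ _ ⟨g, ⟨hg, v, -, hv⟩, rfl⟩ hne w hw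
    obtain rfl := hw.unique (hrank hg hv).1
    rw [(hrank hg hv).2.1]
    exact (hrem f hf).2 g ⟨hg, fun h => hne (congrArg algrem h).symm⟩ w hv
  · rintro _ ⟨f, ⟨hf, -⟩, rfl⟩
    exact hB.algRem_mem δ hf (hrem f hf)
  · rintro _ ⟨f, ⟨hf, v, hvZ, hv⟩, rfl⟩
    exact supported_mono (Set.insert_subset hvZ hZ)
      (hB.algRem_mem_supported δ hδ hr hauto hf (hrem f hf) hv)
  · refine hB.eq_zero_of_reduced δ hδ hr hauto hcs hp fun b hb v hv => ?_
    by_cases hvZ : v ∈ Z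
    · rw [← (hrank hb hv).2.1]
      exact hred _ ⟨b, ⟨hb, v, hvZ, hv⟩, rfl⟩ v (hrank hb hv).1
    · exact algReduced_of_notMem_vars hv
        (fun hvp => hvZ (MvPolynomial.mem_supported.1 hpZ hvp)) v hv
  · rintro _ ⟨_, ⟨f, ⟨hf, v, -, hv⟩, rfl⟩, rfl⟩
    exact (hrank hf hv).2.2
  · rintro _ ⟨_, ⟨f, ⟨hf, v, -, hv⟩, rfl⟩, rfl⟩
    exact hB.separant_algRem_mem δ hδ hr hauto hf (hrem f hf) hv h1

theorem IsTriangularSection.exists_isAlgCharacterizing (hB : IsTriangularSection δ C B)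
    (hC : IsDiffCharSet (satDiffIdeal δ C) C) (h1 : 1 ∉ satDiffIdeal δ C)
    (hZ : reducedVars (leaders C) ⊆ Z)
    {algrem : MvPolynomial (DVar m n) k → MvPolynomial (DVar m n) k}
    (hrem : ∀ f ∈ B, IsAlgRem (B \ {f}) f (algrem f)) :
    ∃ A : Set (MvPolynomial Z k), liftSet A = algrem '' withLeaders B Z ∧
      IsAlgCharacterizing (restrictIdeal (satDiffIdeal δ C) Z) A := by
  have hchar := hB.isCharacterizingOn δ hδ hr hC h1 hZ hrem
  obtain ⟨A, hA⟩ := exists_liftSet_eq hchar.supported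
  refine ⟨A, hA, (hC.1.isAlgCharacterizing_restrictIdeal_iff δ hδ hr h1 hZ).2 ?_⟩
  rwa [hA]

theorem IsDiffCharSet.isAlgCharacterizable_restrictIdeal
    (hC : IsDiffCharSet (satDiffIdeal δ C) C) (h1 : 1 ∉ satDiffIdeal δ C)
    (hZ : reducedVars (leaders C) ⊆ Z) :
    IsAlgCharacterizable (restrictIdeal (satDiffIdeal δ C) Z) := by
  have hwf := hr.wellFoundedLT
  obtain ⟨B, hB⟩ := exists_isTriangularSection δ C
  choose algrem hrem using fun f => (hB.2.1.mono (Set.sdiff_subset (t := {f}))).exists_isAlgRem f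
  obtain ⟨A, -, hA⟩ := hB.exists_isAlgCharacterizing δ hδ hr hC h1 hZ fun f _ => hrem f
  exact ⟨A, hA⟩

section Selection

variable (hC : Autoreduced C) (h1 : 1 ∉ satDiffIdeal δ C) (hZ : reducedVars (leaders C) ⊆ Z)
  (hA : IsCharacterizingOn (satDiffIdeal δ C) Z A)

include hC h1 hZ hA

theorem IsCharacterizingOn.exists_isLeader {v : DVar m n} (hvZ : v ∈ Z)
    (hv : v ∈ thetaVars (leaders C)) :
    ∃ a ∈ A, IsLeader a v ∧ (v ∉ leaders C → a.degreeOf v ≤ 1) := by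
  have hwf := hr.wellFoundedLT
  obtain ⟨B, hB⟩ := exists_isTriangularSection δ C
  rw [← hB.leaders_eq δ hδ hr hC.1] at hv
  obtain ⟨f, hf, hfv⟩ := hv
  obtain ⟨g, hg⟩ := (hB.2.1.mono (Set.sdiff_subset (t := {f}))).exists_isAlgRem f
  obtain ⟨hgv, hdeg, hreg⟩ := hB.hasRegularRank_algRem δ hδ hr hC hf hg hfv h1
  have hgZ : g ∈ supported k Z := supported_mono (Set.insert_subset hvZ hZ)
    (hB.algRem_mem_supported δ hδ hr hC hf hg hfv)
  obtain ⟨r, hr'⟩ := hA.algAutoreduced.triangular.exists_isAlgRem g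
  obtain rfl : r = 0 := hA.eq_zero_of_reduced r
    (hr'.pseudoReduces.mem_of_mem hA.subset (hB.algRem_mem δ hf hg))
    (hr'.pseudoReduces.mem_supported hA.supported hgZ) hr'.2
  obtain ⟨a, ha, hav, hle⟩ := hr'.pseudoReduces.exists_isLeader_of_zero h1 hA.subset
    (Set.subset_union_left.trans hA.HSet_subset) hgv hreg
  refine ⟨a, ha, hav, fun hvC => ?_⟩
  rwa [hdeg, hB.degreeOf_eq_one δ hδ hr hC hf hfv hvC] at hle

theorem IsCharacterizingOn.leaders_subset : leaders C ⊆ leaders A := by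
  intro u hu
  obtain ⟨a, ha, hau, -⟩ := hA.exists_isLeader δ hδ hr hC h1 hZ
    (hZ (subset_reducedVars _ hu)) (subset_thetaVars _ hu)
  exact ⟨a, ha, hau⟩

theorem IsCharacterizingOn.withLeaders_subset_supported :
    withLeaders A (leaders C) ⊆ supported k (reducedVars (leaders C)) := by
  rintro a ⟨ha, u, hu, hau⟩
  refine MvPolynomial.mem_supported.2 fun v hv ⟨hvθ, hvC⟩ => ?_
  obtain ⟨b, hb, hbv, hdeg⟩ := hA.exists_isLeader δ hδ hr hC h1 hZ
    (MvPolynomial.mem_supported.1 (hA.supported ha) hv) hvθ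
  have hab : a ≠ b := by
    rintro rfl
    exact hvC (hau.unique hbv ▸ hu)
  exact (hA.algAutoreduced.2 a ha b hb hab).notMem_vars hbv (hdeg hvC) hv

theorem IsCharacterizingOn.isDiffCharSet (hlead : leaders A ⊆ thetaVars (leaders C)) :
    IsDiffCharSet (satDiffIdeal δ C) (withLeaders A (leaders C)) := by
  have hleadT := leaders_withLeaders (hA.leaders_subset δ hδ hr hC h1 hZ)
  have hsup := hA.withLeaders_subset_supported δ hδ hr hC h1 hZ
  have hsub := withLeaders_subset A (leaders C)
  rw [isDiffCharSet_iff hr h1, hleadT]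
  have hauto := hA.algAutoreduced.mono hsub
  refine ⟨hauto.autoreduced ?_ ?_, hauto, hsub.trans hA.subset, hsup, fun p hp hps hred => ?_⟩
  · rw [hleadT]
    exact hC.isThetaAntichain hr
  · rwa [hleadT]
  · refine hA.eq_zero_of_reduced p hp (supported_mono hZ hps) fun a ha v hv => ?_
    by_cases hvC : v ∈ leaders C
    · exact hred a ⟨ha, v, hvC, hv⟩ v hv
    · exact algReduced_of_notMem_vars hv (fun hvp =>
        MvPolynomial.mem_supported.1 hps hvp ⟨hlead ⟨a, ha, hv⟩, hvC⟩) v hv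

theorem IsCharacterizingOn.isDiffCharacterizing (hlead : leaders A ⊆ thetaVars (leaders C)) :
    IsDiffCharacterizing δ (satDiffIdeal δ C) (withLeaders A (leaders C)) := by
  have hT := hA.isDiffCharSet δ hδ hr hC h1 hZ hlead
  refine hT.isDiffCharacterizing δ hδ hr h1 (Ideal.span_le.2 ?_)
    ((HSet_mono (withLeaders_subset _ _)).trans hA.HSet_subset)
  rintro _ ⟨f, hf, θ, rfl⟩
  exact thetaOp_mem_satDiffIdeal δ hδ (hT.2.1 hf) θ

end Selection

theorem Coherent.leaders_eq (hcoh : Coherent δ C) (hC : Autoreduced C)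
    (h1 : 1 ∉ satDiffIdeal δ C) (hA : IsDiffCharacterizing δ (satDiffIdeal δ C) A) :
    leaders A = leaders C := by
  obtain ⟨hset, hI⟩ := hA
  obtain ⟨hauto, hcs⟩ := (isDiffCharSet_iff hr h1).1 hset
  have hAC := hcoh.leaders_subset δ hδ hr hC.1 hcs
  have hCI := (subset_thetaSet δ C).trans (thetaSet_subset_satDiffIdeal δ C)
  have hreg : initial '' C ⊆ regularMod (satDiffIdeal δ C) :=
    Set.subset_union_left.trans (subset_regularMod_saturation (diffSpan δ C) (HSet C))
  rw [hI] at hset h1 hCI hreg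
  have hCA := hset.leaders_subset δ hδ hr h1 hCI hreg
  exact ((hauto.isThetaAntichain hr).subset_of_subset_thetaVars hAC hCA).antisymm
    ((hC.isThetaAntichain hr).subset_of_subset_thetaVars hCA hAC)

theorem Coherent.isDiffCharacterizable_iff (hcoh : Coherent δ C) (hC : Autoreduced C)
    (h1 : 1 ∉ satDiffIdeal δ C) (hZ : reducedVars (leaders C) ⊆ Z) :
    IsDiffCharacterizable δ (satDiffIdeal δ C) ↔
      IsAlgCharacterizable (restrictIdeal (satDiffIdeal δ C) Z) := by
  constructor
  · rintro ⟨A, hA⟩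
    rw [← hcoh.leaders_eq δ hδ hr hC h1 hA] at hZ
    obtain ⟨hset, hI⟩ := hA
    rw [hI] at hset h1 ⊢
    exact hset.isAlgCharacterizable_restrictIdeal δ hδ hr h1 hZ
  · rintro ⟨A, hA⟩
    have hchar := (hC.isAlgCharacterizing_restrictIdeal_iff δ hδ hr h1 hZ).1 hA
    exact ⟨_, hchar.isDiffCharacterizing δ hδ hr hC h1 hZ
      (hcoh.leaders_subset δ hδ hr hC.1 hchar.toIsCharSetOn)⟩

end Prolongation

section WeakDTriangular

/-! ### Weak d-triangular subsets -/

variable {k : Type*} [Field k] {m n : ℕ} [LinearOrder (DVar m n)] {L : Set (DVar m n)}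
  {A T : Set (MvPolynomial (DVar m n) k)}

theorem Triangular.weakDTriangular_withLeaders (hA : Triangular A) (hL : IsThetaAntichain L) :
    WeakDTriangular (withLeaders A L) := by
  refine ⟨fun f hf => hA.1 f hf.1, ?_⟩
  rintro f ⟨hf, x, hx, hfx⟩ g ⟨hg, y, hy, hgy⟩ hne u v hu hv θ rfl
  obtain rfl := hu.unique hfx
  obtain rfl := hv.unique hgy
  rcases eq_or_ne θ 0 with rfl | hθ
  · rw [DVar.act_zero] at hu
    exact hne (hA.2 f hf g hg v hu hv)
  · exact hL v hy θ hθ hx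

theorem WeakDTriangular.not_lowerRank_withLeaders (hr : IsRanking m n) (hT : WeakDTriangular T)
    (hTA : T ⊆ A) (hlead : leaders A ⊆ thetaVars L) (hL : L ⊆ leaders A) :
    ¬ LowerRank T (withLeaders A L) := by
  rintro ⟨_, ⟨f, hf, v, hv, rfl⟩, hnot, hlow⟩
  obtain ⟨u, hu, θ, rfl⟩ := hlead ⟨f, hTA hf, hv⟩
  have hθ : θ ≠ 0 := by
    rintro rfl
    rw [DVar.act_zero] at hv hnot
    exact hnot ⟨f, ⟨hTA hf, u, hu, hv⟩, u, hv, rfl⟩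
  have hlt := hr.lt_act hθ u
  obtain ⟨a, ha, hau⟩ := hL hu
  obtain ⟨g, hg, w, hw, h⟩ := (hlow _ (Prod.Lex.toLex_lt_toLex.2 (Or.inl hlt))).2
    ⟨a, ⟨ha, u, hu, hau⟩, u, hau, rfl⟩
  obtain ⟨rfl, -⟩ := Prod.mk.inj (toLex.injective h)
  have hfg : f ≠ g := by
    rintro rfl
    exact hlt.ne (hw.unique hv)
  exact hT.2 f hf g hg hfg _ _ hv hw θ rfl

theorem IsMinWeakDTriangular.eq_withLeaders (hT : IsMinWeakDTriangular A T) (hr : IsRanking m n)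
    (hA : Triangular A) (hanti : IsThetaAntichain L) (hlead : leaders A ⊆ thetaVars L)
    (hL : L ⊆ leaders A) : T = withLeaders A L := by
  have hwf := hr.wellFoundedLT
  obtain ⟨hTA, hTw, hmin⟩ := hT
  have hsub := withLeaders_subset A L
  rcases rankSet_eq_or_lowerRank T (withLeaders A L) with heq | hlow | hlow
  · exact (hA.subset_of_rankSet_subset hTA hsub heq.le).antisymm
      (hA.subset_of_rankSet_subset hsub hTA heq.ge)
  · exact absurd hlow (hTw.not_lowerRank_withLeaders hr hTA hlead hL)
  · exact absurd hlow (hmin _ hsub (hA.weakDTriangular_withLeaders hanti))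

end WeakDTriangular

section Canonical

/-! ### Canonical sets -/

variable {σ : Type*} {k : Type*} [Field k]

theorem mem_supported_of_dvd {f g : MvPolynomial σ k} {S : Set σ} (hf : f ∈ supported k S)
    (hf0 : f ≠ 0) (h : g ∣ f) : g ∈ supported k S := by
  obtain ⟨q, rfl⟩ := h
  refine MvPolynomial.mem_supported.2 fun v hv => MvPolynomial.mem_supported.1 hf ?_
  rw [Finset.mem_coe, mem_vars_iff_degreeOf_ne_zero] at hv ⊢
  rw [degreeOf_mul_eq (left_ne_zero_of_mul hf0) (right_ne_zero_of_mul hf0)]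
  exact Nat.ne_of_gt (Nat.add_pos_left (Nat.pos_of_ne_zero hv) _)

theorem exists_rename_val_eq_of_dvd {Z : Set σ} {f : MvPolynomial Z k} (hf : f ≠ 0)
    {g : MvPolynomial σ k} (h : g ∣ rename (Subtype.val : Z → σ) f) :
    ∃ p : MvPolynomial Z k, rename Subtype.val p = g ∧ p ∣ f := by
  have hinj := rename_injective (R := k) (Subtype.val : Z → σ) Subtype.val_injective
  have hf0 := (map_ne_zero_iff _ hinj).2 hf
  have hfs := rename_val_mem_supported f
  obtain ⟨q, hq⟩ := h
  obtain ⟨p, rfl⟩ := exists_rename_val_eq (mem_supported_of_dvd hfs hf0 (Dvd.intro _ hq.symm))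
  obtain ⟨r, rfl⟩ := exists_rename_val_eq (mem_supported_of_dvd hfs hf0 (Dvd.intro_left _ hq.symm))
  exact ⟨p, rfl, Dvd.intro r (hinj (by rw [map_mul, hq]))⟩

theorem IsCanonicalForm.withLeaders_liftSet {m n : ℕ} [LinearOrder (DVar m n)]
    {L Z : Set (DVar m n)} {A : Set (MvPolynomial Z k)} (hA : IsCanonicalForm A)
    (hlead : leaders (liftSet A) ⊆ thetaVars L)
    (hsup : withLeaders (liftSet A) L ⊆ supported k (reducedVars L)) :
    IsCanonicalForm (withLeaders (liftSet A) L) := by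
  have hval := Subtype.strictMono_coe Z
  rintro _ ⟨⟨f, hf, rfl⟩, u, hu, hfu⟩
  obtain ⟨hinit, hfactor, hmonic⟩ := hA f hf
  refine ⟨?_, fun g hgf hg => ?_, hmonic.rename hval⟩
  · rintro _ ⟨_, ⟨⟨a, ha, rfl⟩, -⟩, hav⟩ hv
    obtain ⟨v, rfl, hav'⟩ := hav.exists_of_rename hval
    rw [initial_rename hval, mem_vars_rename_iff hval.injective] at hv
    exact hinit v ⟨a, ha, hav'⟩ hv
  · have hf0 : f ≠ 0 := by
      rintro rfl
      exact hfu.ne_zero (map_zero _)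
    have hgs := mem_supported_of_dvd (hsup ⟨⟨f, hf, rfl⟩, u, hu, hfu⟩) hfu.ne_zero hgf
    obtain ⟨p, rfl, hpf⟩ := exists_rename_val_eq_of_dvd hf0 hgf
    rw [← Finset.not_nonempty_iff_eq_empty, vars_rename_nonempty_iff hval.injective,
      Finset.not_nonempty_iff_eq_empty]
    refine hfactor p hpf ?_
    rintro v ⟨a, ha, hav⟩ hv
    replace hav := (isLeader_rename_iff hval).2 hav
    replace hv := (mem_vars_rename_iff hval.injective).2 hv
    have hvL : (v : DVar m n) ∈ L := by_contra fun hvL =>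
      MvPolynomial.mem_supported.1 hgs hv ⟨hlead ⟨_, ⟨a, ha, rfl⟩, hav⟩, hvL⟩
    exact hg v ⟨_, ⟨⟨a, ha, rfl⟩, v, hvL, hav⟩, hav⟩ hv

end Canonical

end DiffAlg

open DiffAlg in
theorem lemmal_general {k : Type*} [Field k] [CharZero k] {m n : ℕ}
    (δ : Fin m → Derivation ℤ k k) (hδ : ∀ i j a, δ i (δ j a) = δ j (δ i a))
    [LinearOrder (DVar m n)] (hrank : IsRanking m n) :
    (∀ (C : Set (MvPolynomial (DVar m n) k)) (L' : Set (DVar m n)),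
      Autoreduced C → leaders C ⊆ L' →
        ((satDiffIdeal δ C).IsPrime ↔
          (restrictIdeal (satDiffIdeal δ C) (prolongationVars (leaders C) L')).IsPrime) ∧
        (Coherent δ C → 1 ∉ satDiffIdeal δ C →
          (IsDiffCharacterizable δ (satDiffIdeal δ C) ↔ IsAlgCharacterizable
            (restrictIdeal (satDiffIdeal δ C) (prolongationVars (leaders C) L'))))) ∧
    (∀ (C : Set (MvPolynomial (DVar m n) k)) (L' : Set (DVar m n)),
      IsDiffCharSet (satDiffIdeal δ C) C → 1 ∉ satDiffIdeal δ C → leaders C ⊆ L' →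
        ((∃ B, IsTriangularSection δ C B) ∧
          ∀ B, IsTriangularSection δ C B →
            (∀ f ∈ B, ∃ g, IsAlgRem (B \ {f}) f g) ∧
            ∀ algrem : MvPolynomial (DVar m n) k → MvPolynomial (DVar m n) k,
              (∀ f ∈ B, IsAlgRem (B \ {f}) f (algrem f)) →
              ∃ A : Set (MvPolynomial (prolongationVars (leaders C) L') k),
                liftSet A = {g | ∃ f ∈ B, (∃ u ∈ L', IsLeader f u) ∧ g = algrem f} ∧
                IsAlgCharacterizing
                  (restrictIdeal (satDiffIdeal δ C) (prolongationVars (leaders C) L')) A) ∧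
        (∀ A : Set (MvPolynomial (prolongationVars (leaders C) L') k),
          IsAlgCharacterizing
            (restrictIdeal (satDiffIdeal δ C) (prolongationVars (leaders C) L')) A →
          ∀ T, IsMinWeakDTriangular (liftSet A) T →
            IsDiffCharacterizing δ (satDiffIdeal δ C) T ∧
              (IsCanonicalForm A → IsCanonicalForm T))) := by
  have hwf := hrank.wellFoundedLT
  refine ⟨fun C L' hC hL => ?_, fun C L' hC h1 hL => ?_⟩ <;>
    have hZ := reducedVars_subset_prolongationVars hL
  · exact ⟨hC.isPrime_iff_restrictIdeal δ hδ hrank hZ,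
      fun hcoh h1 => hcoh.isDiffCharacterizable_iff δ hδ hrank hC h1 hZ⟩
  · refine ⟨⟨exists_isTriangularSection δ C, fun B hB =>
      ⟨fun f _ => (hB.2.1.mono Set.sdiff_subset).exists_isAlgRem f, fun algrem hrem => ?_⟩⟩,
      fun A hA T hT => ?_⟩
    · obtain ⟨A, hlift, hA⟩ := hB.exists_isAlgCharacterizing δ hδ hrank hC h1 hZ hrem
      refine ⟨A, ?_, hA⟩
      rw [hlift, withLeaders_prolongationVars (hB.leaders_eq δ hδ hrank hC.1.1).le]
      ext g
      simp only [withLeaders, Set.mem_image, Set.mem_ofPred_eq, and_assoc, eq_comm]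
    · have hA := (hC.1.isAlgCharacterizing_restrictIdeal_iff δ hδ hrank h1 hZ).1 hA
      have hlead := hC.leaders_subset δ hδ hrank h1 hA.subset
        (Set.subset_union_left.trans hA.HSet_subset)
      rw [hT.eq_withLeaders hrank hA.algAutoreduced.triangular (hC.1.isThetaAntichain hrank) hlead
        (hA.leaders_subset δ hδ hrank hC.1 h1 hZ)]
      exact ⟨hA.isDiffCharacterizing δ hδ hrank hC.1 h1 hZ hlead, fun hcan =>
        hcan.withLeaders_liftSet hlead (hA.withLeaders_subset_supported δ hδ hrank hC.1 h1 hZ)⟩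

theorem lemmal {k : Type*} [Field k] [CharZero k] {m n : ℕ}
    (δ : Fin m → Derivation ℤ k k) (hδ : ∀ i j a, δ i (δ j a) = δ j (δ i a))
    [LinearOrder (DiffAlg.DVar m n)] (hrank : DiffAlg.IsRanking m n) :
    (∀ C D : Set (MvPolynomial (DiffAlg.DVar m n) k),
      DiffAlg.Autoreduced C → DiffAlg.Coherent δ C → DiffAlg.IsProlongation δ C D →
      1 ∉ DiffAlg.satDiffIdeal δ C →
        ((DiffAlg.satDiffIdeal δ C).IsPrime ↔
          (DiffAlg.restrictIdeal (DiffAlg.satDiffIdeal δ C)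
            (DiffAlg.prolongationVars (DiffAlg.leaders C) (DiffAlg.leaders D))).IsPrime) ∧
        (DiffAlg.IsDiffCharacterizable δ (DiffAlg.satDiffIdeal δ C) ↔
          DiffAlg.IsAlgCharacterizable (DiffAlg.restrictIdeal (DiffAlg.satDiffIdeal δ C)
            (DiffAlg.prolongationVars (DiffAlg.leaders C) (DiffAlg.leaders D))))) ∧
    (∀ (C : Set (MvPolynomial (DiffAlg.DVar m n) k)) (L' : Set (DiffAlg.DVar m n)),
      DiffAlg.IsDiffCharSet (DiffAlg.satDiffIdeal δ C) C →
      1 ∉ DiffAlg.satDiffIdeal δ C →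
      DiffAlg.IsVarProlongation (DiffAlg.leaders C) L' →
        ((∃ B, DiffAlg.IsTriangularSection δ C B) ∧
          ∀ B, DiffAlg.IsTriangularSection δ C B →
            (∀ f ∈ B, ∃ g, DiffAlg.IsAlgRem (B \ {f}) f g) ∧
            ∀ algrem : MvPolynomial (DiffAlg.DVar m n) k → MvPolynomial (DiffAlg.DVar m n) k,
              (∀ f ∈ B, DiffAlg.IsAlgRem (B \ {f}) f (algrem f)) →
              ∃ A : Set (MvPolynomial
                  (DiffAlg.prolongationVars (DiffAlg.leaders C) L') k),
                DiffAlg.liftSet A =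
                  {g | ∃ f ∈ B, (∃ u ∈ L', DiffAlg.IsLeader f u) ∧ g = algrem f} ∧
                DiffAlg.IsAlgCharacterizing (DiffAlg.restrictIdeal (DiffAlg.satDiffIdeal δ C)
                  (DiffAlg.prolongationVars (DiffAlg.leaders C) L')) A) ∧
        (∀ A : Set (MvPolynomial (DiffAlg.prolongationVars (DiffAlg.leaders C) L') k),
          DiffAlg.IsAlgCharacterizing (DiffAlg.restrictIdeal (DiffAlg.satDiffIdeal δ C)
            (DiffAlg.prolongationVars (DiffAlg.leaders C) L')) A →
          ∀ T, DiffAlg.IsMinWeakDTriangular (DiffAlg.liftSet A) T →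
            (DiffAlg.Autoreduced T →
              DiffAlg.IsDiffCharacterizing δ (DiffAlg.satDiffIdeal δ C) T) ∧
            (DiffAlg.IsCanonicalForm A →
              DiffAlg.IsDiffCharacterizing δ (DiffAlg.satDiffIdeal δ C) T ∧
                DiffAlg.IsCanonicalForm T))) := by
  obtain ⟨h₁, h₂⟩ := lemmal_general δ hδ hrank
  refine ⟨fun C D hC hcoh hD h1 => (h₁ C _ hC (DiffAlg.leaders_mono hD.1)).imp_right
    fun h => h hcoh h1, fun C L' hC h1 hL => (h₂ C L' hC h1 hL.1).imp_right
    fun h A hA T hT => ?_⟩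
  obtain ⟨hchar, hcan⟩ := h A hA T hT
  exact ⟨fun _ => hchar, fun hA => ⟨hchar, hcan hA⟩⟩
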